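/- **Rao–Kupper model.** Fix $\theta>1$ and an integer $T\ge 1$. Set $$f(1;y)=\frac{e^y}{e^y+\theta},\qquad f(0;y)=\frac{(\theta^2-1)e^y}{(e^y+\theta)(\theta e^y+1)},\qquad f(-1;y)=\frac{1}{\theta e^y+1}.$$ For each $n$ let $p_n\in[0,1]$ and let $\mathbf u=\mathbf u^{(n)}\in\mathbb R^n$ be a score vector with $u_1=0$; write $M_n=\max_{i,j}|u_i-u_j|$. For every pair $1\le i<j\le n$ one observes $n_{ij}\sim \mathrm{Bin}(T,p_n)$ comparisons, with outcomes $X_{ij}^{(t)}\in\{-1,0,1\}$, $1\le t\le n_{ij}$, of mass function $f(\cdot\,;u_i-u_j)$; all the numbers $n_{ij}$ and all the outcomes are independent. The log-likelihood is $l(\mathbf v)=\sum_{i<j}\sum_{t\le n_{ij}}\log f(X_{ij}^{(t)};v_i-v_j)$, and a maximum likelihood estimate (MLE) $\hat{\mathbf u}$ is a maximizer of $l$ over $\{\mathbf v\in\mathbb R^n: v_1=0\}$. Assume that for some constant $c>1$ one has $p_n\ge c\,\frac{\log n}{n}$ for all large $n$, and that $$\Delta_n:=e^{2M_n}\sqrt{\frac{\log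 n}{np_n}}\;\frac{\log n}{\log (np_n)}\longrightarrow 0\qquad(n\to\infty).$$ Then the MLE is uniformly consistent: 1. there is a constant $C$ independent of $n$ such that, for all sufficiently large $n$, with probability at least $1-14n^{-2}$ the MLE $\hat{\mathbf u}$ exists, is unique, and satisfies $\|\hat{\mathbf u}-\mathbf u\|_\infty\le C\Delta_n$; 2. consequently, for any joint realization of the data for all $n$ on one probability space, almost surely the MLE exists and is unique for all but finitely many $n$, and $\|\hat{\mathbf u}-\mathbf u\|_\infty\to 0$ as $n\to\infty$. -/

import Mathlib

open Filter Topology MeasureTheory ProbabilityTheory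

/-- Outcomes of a comparison live in `SignType = {-1, 0, 1}` (loss, tie, win), which carries the
discrete σ-algebra. -/
instance instMeasurableSpaceSignType : MeasurableSpace SignType := ⊤

instance instDiscreteMeasurableSpaceSignType : DiscreteMeasurableSpace SignType := ⟨fun _ => trivial⟩

namespace RaoKupper

noncomputable section

/-- The Rao–Kupper link function `f(x; y)` with threshold `θ`: the probability that a subject whose
relative score against its opponent is `y` obtains the outcome `x`
(`1` = win, `0` = tie, `-1` = loss). -/
def link (θ : ℝ) : SignType → ℝ → ℝ
  | .pos, y => Real.exp y / (Real.exp y + θ)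
  | .zero, y => (θ ^ 2 - 1) * Real.exp y / ((Real.exp y + θ) * (θ * Real.exp y + 1))
  | .neg, y => 1 / (θ * Real.exp y + 1)

/-- The law of a single comparison: the measure on `{-1, 0, 1}` with mass function `f(·; y)`. -/
def outcomeLaw (θ y : ℝ) : Measure SignType :=
  ∑ x : SignType, ENNReal.ofReal (link θ x y) • Measure.dirac x

/-- The pairs `(i, j)` of subjects with `i < j`. -/
abbrev Pair (n : ℕ) : Type := {e : Fin n × Fin n // e.1 < e.2}

/-- The data for `n` subjects: every pair `i < j` carries the number `n_ij` of its observed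
comparisons and a list of (potential) outcomes, seen from `i`, of which only the first `n_ij` are
observed. -/
abbrev Data (n T : ℕ) : Type := Pair n → ℕ × (Fin T → SignType)

/-- The law of the data in the Rao–Kupper model with score vector `u`: all the `n_ij` and all the
outcomes are independent, `n_ij` is binomial `Bin(T, p)`, and each outcome of the pair `(i, j)`
has the mass function `f(·; u_i - u_j)`. -/
def dataLaw (θ : ℝ) (T : ℕ) (p : unitInterval) {n : ℕ} (u : Fin n → ℝ) : Measure (Data n T) :=
  Measure.pi fun e : Pair n =>
    (ProbabilityTheory.binomial T p).prod
      (Measure.pi fun _ : Fin T => outcomeLaw θ (u e.1.1 - u e.1.2))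

/-- The log-likelihood `l(v) = ∑_{i < j} ∑_{t ≤ n_ij} log f(X_ij^(t); v_i - v_j)`, a function of the
observed comparisons only. -/
def logLikelihood (θ : ℝ) {n T : ℕ} (d : Data n T) (v : Fin n → ℝ) : ℝ :=
  ∑ e : Pair n, ∑ t : Fin T with t.val < (d e).1,
    Real.log (link θ ((d e).2 t) (v e.1.1 - v e.1.2))

/-- The score vectors whose first coordinate vanishes (the identifiability constraint). -/
def normalized (n : ℕ) : Set (Fin n → ℝ) := {v | ∀ i : Fin n, i.val = 0 → v i = 0}

/-- `v` is a maximum likelihood estimate: it maximizes the log-likelihood over all score vectors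
with first coordinate `0`. -/
def IsMLE (θ : ℝ) {n T : ℕ} (d : Data n T) (v : Fin n → ℝ) : Prop :=
  v ∈ normalized n ∧ IsMaxOn (logLikelihood θ d) (normalized n) v

/-- The dynamic range `M_n = max_{i,j} |u_i - u_j|`. -/
def dynamicRange {n : ℕ} (u : Fin n → ℝ) : ℝ := ⨆ e : Fin n × Fin n, |u e.1 - u e.2|

/-- The quantity `Δ_n = e^{2 M_n} √(log n / (n p_n)) · log n / log (n p_n)`. -/
def rate {n : ℕ} (p : unitInterval) (u : Fin n → ℝ) : ℝ :=
  Real.exp (2 * dynamicRange u) * √(Real.log n / (n * (p : ℝ))) *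
    (Real.log n / Real.log (n * (p : ℝ)))

end

end RaoKupper

/-!
Write `δ = û - u` for the error of a maximum likelihood estimate. The likelihood equations say that
at `û` the scores of all comparisons of a subject `i` sum to zero. Since the score of a single
comparison is strictly decreasing in the score difference, the difference between the scores at `u`
and at `û` is a flow on the comparison graph which runs down the potential `δ`, and a drop of
`h ≤ 1` in `δ` sends at least `h * e ^ (-M) / (4 * e * θ)` through each comparison. The net flow out
of `i` is the sum of its scores at `u`, a centred sum which is at most `(T + 3) * √(n * p * log n)`
with high probability.

The comparison graph expands: with high probability, every set `A` has more than `n * p / 8 * #A`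
comparisons with the complement of any set `A' ⊇ A` of size at most `n / 2` and at most
`n * p / (64 * log n) * #A`. If `h` is a suitable multiple of `e ^ M * √(log n / (n * p))`, then the
flow out of a superlevel set of `δ` is too small to cross the graph in this way, so lowering the
level by `h` multiplies the size of the superlevel set by more than `n * p / (64 * log n)` until it
exceeds `n / 2`. This takes at most `5 * log n / log (n * p)` steps, because `Δ_n → 0` forces
`n * p ≥ (log n) ^ 2`. Running the argument from the maximum and from the minimum of `δ`, the two
superlevel sets meet in the middle, and the oscillation of `δ` is bounded by a multiple of `Δ_n`.

The same expansion gives Ford's condition, hence existence of the estimate by compactness, and the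
flow argument applied to two estimates gives uniqueness.
-/

namespace RaoKupper

noncomputable section

/-! ### A single comparison -/

/-- The score function `∂_y log f(x; y)` of a single comparison. -/
def score (θ : ℝ) : SignType → ℝ → ℝ
  | .pos, y => 1 - Real.sigmoid (y - Real.log θ)
  | .zero, y => Real.sigmoid (-y - Real.log θ) - Real.sigmoid (y - Real.log θ)
  | .neg, y => Real.sigmoid (-y - Real.log θ) - 1

/-- The modulus of strict monotonicity of the score function on `[-M, M]`: the derivative of the
sigmoid is at least `e^{-|z|} / 4`, and `|z| ≤ log θ + M + 1` at all points where it is needed. -/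
def slope (θ M : ℝ) : ℝ := Real.exp (-(M + 1)) / (4 * θ)

lemma exp_neg_abs_div_four_le (z : ℝ) :
    Real.exp (-|z|) / 4 ≤ Real.sigmoid z * (1 - Real.sigmoid z) := by
  rw [← Real.sigmoid_neg, Real.sigmoid_def, Real.sigmoid_def, neg_neg, ← mul_inv, Real.exp_neg,
    div_eq_mul_inv, ← mul_inv]
  refine inv_anti₀ (by positivity) ?_
  have h1 : 1 ≤ Real.exp |z| := Real.one_le_exp (abs_nonneg z)
  have h2 : Real.exp z ≤ Real.exp |z| := Real.exp_le_exp.2 (le_abs_self z)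
  have h3 : Real.exp (-z) ≤ Real.exp |z| := Real.exp_le_exp.2 (neg_le_abs z)
  have h4 : Real.exp (-z) * Real.exp z = 1 := by rw [← Real.exp_add, neg_add_cancel, Real.exp_zero]
  linarith

lemma exp_div_four_mul_le_sigmoid_sub {m x y : ℝ} (hxy : x ≤ y) (hx : -m ≤ x) (hy : y ≤ m) :
    Real.exp (-m) / 4 * (y - x) ≤ Real.sigmoid y - Real.sigmoid x := by
  refine (convex_Icc x y).mul_sub_le_image_sub_of_le_deriv continuous_sigmoid.continuousOn
    differentiable_sigmoid.differentiableOn (fun z hz => ?_) x (Set.left_mem_Icc.2 hxy) y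
    (Set.right_mem_Icc.2 hxy) hxy
  have hz' := interior_subset hz
  have hzm : |z| ≤ m := abs_le.2 ⟨hx.trans hz'.1, hz'.2.trans hy⟩
  rw [Real.deriv_sigmoid]
  exact le_trans (by gcongr) (exp_neg_abs_div_four_le z)

section SingleComparison

variable {θ : ℝ}

lemma score_neg (x : SignType) (y : ℝ) : score θ (-x) (-y) = -score θ x y := by
  cases x <;> simp [score]

lemma score_antitone (x : SignType) : Antitone (score θ x) := by
  intro y z hyz
  have h1 := Real.sigmoid_monotone (sub_le_sub_right hyz (Real.log θ))
  have h2 := Real.sigmoid_monotone (sub_le_sub_right (neg_le_neg hyz) (Real.log θ))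
  cases x <;> simp only [score] <;> linarith

lemma abs_score_le_one (x : SignType) (y : ℝ) : |score θ x y| ≤ 1 := by
  have h1 := Real.sigmoid_pos (y - Real.log θ)
  have h2 := Real.sigmoid_pos (-y - Real.log θ)
  have h3 := Real.sigmoid_le_one (y - Real.log θ)
  have h4 := Real.sigmoid_le_one (-y - Real.log θ)
  rw [abs_le]
  cases x <;> simp only [score] <;> constructor <;> linarith

lemma slope_pos (hθ : 0 < θ) (M : ℝ) : 0 < slope θ M := by
  unfold slope
  positivity

lemma slope_eq (hθ : 0 < θ) (M : ℝ) : slope θ M = Real.exp (-(Real.log θ + M + 1)) / 4 := by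
  rw [slope, add_assoc, neg_add (Real.log θ), Real.exp_add, Real.exp_neg (Real.log θ),
    Real.exp_log hθ]
  field_simp

lemma slope_mul_le_score_sub (hθ : 1 ≤ θ) (x : SignType) {M h y z : ℝ} (hy : |y| ≤ M)
    (h0 : 0 ≤ h) (h1 : h ≤ 1) (hz : y + h ≤ z) :
    slope θ M * h ≤ score θ x y - score θ x z := by
  obtain ⟨hy1, hy2⟩ := abs_le.1 hy
  have hlog := Real.log_nonneg hθ
  have hslope := mul_nonneg (slope_pos (zero_lt_one.trans_le hθ) M).le h0
  rw [slope_eq (zero_lt_one.trans_le hθ)] at hslope ⊢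
  have hwin := exp_div_four_mul_le_sigmoid_sub (m := Real.log θ + M + 1)
    (x := y - Real.log θ) (y := y + h - Real.log θ) (by linarith) (by linarith) (by linarith)
  have hloss := exp_div_four_mul_le_sigmoid_sub (m := Real.log θ + M + 1)
    (x := -(y + h) - Real.log θ) (y := -y - Real.log θ) (by linarith) (by linarith) (by linarith)
  rw [sub_sub_sub_cancel_right, add_sub_cancel_left] at hwin
  rw [sub_sub_sub_cancel_right, neg_sub_neg, add_sub_cancel_left] at hloss
  have hanti := score_antitone (θ := θ) x hz
  cases x <;> simp only [score] at hanti ⊢ <;> linarith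

lemma slope_le_score_one (hθ : 1 ≤ θ) {M y : ℝ} (hy : |y| ≤ M) : slope θ M ≤ score θ 1 y := by
  have hdrop := slope_mul_le_score_sub hθ 1 hy zero_le_one le_rfl le_rfl
  have hpos : 0 < score θ 1 (y + 1) := sub_pos.2 (Real.sigmoid_lt_one _)
  linarith

lemma link_pos_eq_sigmoid (hθ : 0 < θ) (y : ℝ) :
    link θ .pos y = Real.sigmoid (y - Real.log θ) := by
  rw [link, Real.sigmoid_def, neg_sub, Real.exp_sub, Real.exp_log hθ]
  field_simp

lemma link_neg_eq_sigmoid (hθ : 0 < θ) (y : ℝ) :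
    link θ .neg y = Real.sigmoid (-y - Real.log θ) := by
  rw [link, Real.sigmoid_def, neg_sub, sub_neg_eq_add, Real.exp_add, Real.exp_log hθ]
  field_simp
  ring

lemma link_zero_eq_sigmoid (hθ : 0 < θ) (y : ℝ) :
    link θ .zero y = (θ ^ 2 - 1) * (Real.sigmoid (y - Real.log θ) *
      Real.sigmoid (-y - Real.log θ)) := by
  rw [← link_pos_eq_sigmoid hθ, ← link_neg_eq_sigmoid hθ, link, link, link]
  field_simp

lemma link_neg (hθ : 0 < θ) (x : SignType) (y : ℝ) : link θ (-x) (-y) = link θ x y := by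
  cases x
  · rw [show -SignType.zero = .zero from rfl, link_zero_eq_sigmoid hθ, link_zero_eq_sigmoid hθ,
      neg_neg, mul_comm (Real.sigmoid _)]
  · rw [show -SignType.neg = .pos from rfl, link_pos_eq_sigmoid hθ, link_neg_eq_sigmoid hθ]
  · rw [show -SignType.pos = .neg from rfl, link_pos_eq_sigmoid hθ, link_neg_eq_sigmoid hθ, neg_neg]

lemma link_pos (hθ : 1 < θ) (x : SignType) (y : ℝ) : 0 < link θ x y := by
  have : 0 < θ ^ 2 - 1 := by nlinarith
  cases x <;> simp only [link] <;> positivity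

lemma sum_link (hθ : 0 < θ) (y : ℝ) : ∑ x, link θ x y = 1 := by
  rw [SignType.univ_eq, Finset.sum_insert (by decide), Finset.sum_pair (by decide)]
  simp only [link]
  field_simp
  ring

lemma link_le_one (hθ : 1 < θ) (x : SignType) (y : ℝ) : link θ x y ≤ 1 := by
  rw [← sum_link (by linarith) y]
  exact Finset.single_le_sum (f := fun x => link θ x y) (fun x _ => (link_pos hθ x y).le)
    (Finset.mem_univ x)

lemma hasDerivAt_log_link (hθ : 1 < θ) (x : SignType) (y : ℝ) :
    HasDerivAt (fun z => Real.log (link θ x z)) (score θ x y) y := by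
  have hlog (z : ℝ) : HasDerivAt (fun z => Real.log (Real.sigmoid z)) (1 - Real.sigmoid z) z := by
    refine ((Real.hasDerivAt_sigmoid z).log (Real.sigmoid_pos z).ne').congr_deriv ?_
    rw [mul_div_cancel_left₀ _ (Real.sigmoid_pos z).ne']
  have hwin : HasDerivAt (fun z => Real.log (Real.sigmoid (z - Real.log θ)))
      (1 - Real.sigmoid (y - Real.log θ)) y := (hlog _).comp_sub_const y (Real.log θ)
  have hloss : HasDerivAt (fun z => Real.log (Real.sigmoid (-z - Real.log θ)))
      (Real.sigmoid (-y - Real.log θ) - 1) y :=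
    ((hlog _).comp y ((hasDerivAt_neg y).sub_const (Real.log θ))).congr_deriv (by ring)
  have hθ0 : 0 < θ := by linarith
  cases x
  · have hcoef : θ ^ 2 - 1 ≠ 0 := by nlinarith
    simp only [link_zero_eq_sigmoid hθ0, Real.log_mul hcoef
      (mul_pos (Real.sigmoid_pos _) (Real.sigmoid_pos _)).ne',
      Real.log_mul (Real.sigmoid_pos _).ne' (Real.sigmoid_pos _).ne']
    exact ((hwin.add hloss).const_add _).congr_deriv (by rw [score]; ring)
  · simpa only [link_neg_eq_sigmoid hθ0, score] using hloss
  · simpa only [link_pos_eq_sigmoid hθ0, score] using hwin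

lemma sum_link_mul_score (hθ : 0 < θ) (y : ℝ) : ∑ x, link θ x y * score θ x y = 0 := by
  have hsum := sum_link hθ y
  simp only [SignType.univ_eq, Finset.sum_insert (show (0 : SignType) ∉ {-1, 1} by decide),
    Finset.sum_pair (show (-1 : SignType) ≠ 1 by decide), score] at hsum ⊢
  change link θ .zero y + (link θ .neg y + link θ .pos y) = 1 at hsum
  change link θ .zero y * _ + (link θ .neg y * _ + link θ .pos y * _) = 0
  simp only [link_zero_eq_sigmoid hθ, link_neg_eq_sigmoid hθ, link_pos_eq_sigmoid hθ] at hsum ⊢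
  linear_combination (Real.sigmoid (-y - Real.log θ) - Real.sigmoid (y - Real.log θ)) * hsum

lemma log_link_le_of_ne_one (hθ : 1 < θ) {x : SignType} (hx : x ≠ 1) (y : ℝ) :
    Real.log (link θ x y) ≤ Real.log θ - y := by
  rw [Real.log_le_iff_le_exp (link_pos hθ x y), Real.exp_sub, Real.exp_log (by linarith),
    le_div_iff₀ (Real.exp_pos y)]
  have hy := Real.exp_pos y
  cases x
  · rw [link, div_mul_eq_mul_div, div_le_iff₀ (by positivity)]
    nlinarith [mul_pos hy hy, mul_pos hy (show 0 < θ by linarith)]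
  · rw [link, div_mul_eq_mul_div, div_le_iff₀ (by positivity)]
    nlinarith [mul_lt_mul_of_pos_right (show 1 < θ * θ by nlinarith) hy]
  · exact absurd rfl hx

end SingleComparison

/-! ### Flows on weighted graphs -/

section PairSums

variable {V R : Type*} [Fintype V] [LinearOrder V]

lemma sum_sum_eq_sum_lt_add_sum_diag [AddCommMonoid R] (F : V → V → R) :
    ∑ i, ∑ j, F i j =
      ∑ e : {e : V × V // e.1 < e.2}, (F e.1.1 e.1.2 + F e.1.2 e.1.1) + ∑ i, F i i := by
  have hlt (G : V → V → R) :
      ∑ i, ∑ j, (if i < j then G i j else 0) = ∑ e : {e : V × V // e.1 < e.2}, G e.1.1 e.1.2 := by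
    rw [← Fintype.sum_prod_type', ← Finset.sum_filter]
    exact Finset.sum_subtype _ (by simp) _
  have hsplit (i j : V) : F i j = (if i < j then F i j else 0) +
      (if j < i then F i j else 0) + (if i = j then F i j else 0) := by
    rcases lt_trichotomy i j with h | h | h
    · simp [h, h.ne, h.not_gt]
    · simp [h]
    · simp [h, h.ne', h.not_gt]
  have hdiag : ∑ i, ∑ j, (if i = j then F i j else 0) = ∑ i, F i i := by simp
  rw [Finset.sum_add_distrib, ← hlt, ← hlt fun i j => F j i, ← hdiag,
    Finset.sum_comm (f := fun i j => if i < j then F j i else 0)]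
  simp only [← Finset.sum_add_distrib, ← hsplit]

lemma sum_lt_mul_sub_eq_sum_mul_sum {γ : V → V → ℝ} (hγ : ∀ i j, γ j i = -γ i j) (w : V → ℝ) :
    ∑ e : {e : V × V // e.1 < e.2}, γ e.1.1 e.1.2 * (w e.1.1 - w e.1.2) =
      ∑ i, w i * ∑ j, γ i j := by
  have hdiag (i : V) : γ i i = 0 := by linarith [hγ i i]
  simp only [Finset.mul_sum]
  rw [sum_sum_eq_sum_lt_add_sum_diag]
  simp only [hdiag, mul_zero, Finset.sum_const_zero, add_zero]
  refine Finset.sum_congr rfl fun e _ => ?_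
  rw [hγ e.1.1 e.1.2]
  ring

end PairSums

/-- The total weight sent from `A` to `B` by the weights `N` on ordered pairs. -/
def cutWeight {V : Type*} (N : V → V → ℝ) (A B : Finset V) : ℝ := ∑ i ∈ A, ∑ j ∈ B, N i j

/-- The set of vertices at which a potential `δ` is at least `x`. A flow running down `δ` can only
leave such a set, so expansion forces these sets to grow as `x` decreases. -/
def superlevel {V : Type*} [Fintype V] (δ : V → ℝ) (x : ℝ) : Finset V := {i | x ≤ δ i}

/-- Quantitative expansion of a weighted graph: a set `A` sends weight more than `q * #A` outside
every set `A'` at most `r` times larger that contains at most half of the vertices. -/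
def Expands {V : Type*} [Fintype V] [DecidableEq V] (N : V → V → ℝ) (r q : ℝ) : Prop :=
  ∀ A A' : Finset V, A.Nonempty → A ⊆ A' → 2 * A'.card ≤ Fintype.card V →
    (A'.card : ℝ) ≤ r * A.card → q * A.card < cutWeight N A A'ᶜ

/-- `γ` is a flow running down the potential `δ`, which carries at least `a` times the weight `N`
across every potential drop of at least `h`. -/
structure IsDownwardFlow {V : Type*} (N : V → V → ℝ) (δ : V → ℝ) (a h : ℝ) (γ : V → V → ℝ) :
    Prop where
  skew : ∀ i j, γ j i = -γ i j
  nonneg : ∀ i j, δ j ≤ δ i → 0 ≤ γ i j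
  mul_le : ∀ i j, h ≤ δ i - δ j → a * N i j ≤ γ i j

section Flows

variable {V : Type*}

lemma cutWeight_comm {N : V → V → ℝ} (hN : ∀ i j, N j i = N i j) (A B : Finset V) :
    cutWeight N A B = cutWeight N B A := by
  rw [cutWeight, Finset.sum_comm]
  simp only [cutWeight, hN]

lemma cutWeight_swap_of_skew {γ : V → V → ℝ} (hγ : ∀ i j, γ j i = -γ i j) (A B : Finset V) :
    cutWeight γ B A = -cutWeight γ A B := by
  rw [cutWeight, Finset.sum_comm]
  simp only [cutWeight, ← hγ, ← Finset.sum_neg_distrib]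

lemma IsDownwardFlow.neg {N γ : V → V → ℝ} {δ : V → ℝ} {a h : ℝ} (H : IsDownwardFlow N δ a h γ)
    (hN : ∀ i j, N j i = N i j) : IsDownwardFlow N (-δ) a h (-γ) where
  skew i j := by simp only [Pi.neg_apply, H.skew i j]
  nonneg i j hij := by
    simpa only [Pi.neg_apply, ← H.skew] using H.nonneg j i (neg_le_neg_iff.1 hij)
  mul_le i j hij := by
    have hji : h ≤ δ j - δ i := by simpa only [Pi.neg_apply, neg_sub_neg] using hij
    simpa only [Pi.neg_apply, ← H.skew, hN] using H.mul_le j i hji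

variable [Fintype V]

lemma mem_superlevel {δ : V → ℝ} {x : ℝ} {i : V} : i ∈ superlevel δ x ↔ x ≤ δ i := by
  simp [superlevel]

lemma superlevel_antitone (δ : V → ℝ) : Antitone (superlevel δ) := fun _ _ hxy _ hi =>
  mem_superlevel.2 (hxy.trans (mem_superlevel.1 hi))

lemma card_lt_two_mul_card_of_growth {B : ℕ → Finset V} (hmono : Monotone B)
    (h0 : (B 0).Nonempty) {r : ℝ} (hr : 1 ≤ r)
    (hstep : ∀ k, Fintype.card V < 2 * (B (k + 1)).card ∨ r * (B k).card < (B (k + 1)).card)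
    {K : ℕ} (hK : (Fintype.card V : ℝ) ≤ r ^ K) : Fintype.card V < 2 * (B K).card := by
  have hgrow (k : ℕ) : Fintype.card V < 2 * (B k).card ∨ r ^ k ≤ (B k).card := by
    induction k with
    | zero => exact Or.inr (by simpa using h0)
    | succ k ih =>
      rcases ih with ih | ih
      · have := Finset.card_le_card (hmono (Nat.le_add_right k 1))
        exact Or.inl (by lia)
      · refine (hstep k).imp_right fun h => ?_
        calc r ^ (k + 1) = r * r ^ k := by ring
          _ ≤ r * (B k).card := by gcongr
          _ ≤ (B (k + 1)).card := h.le
  rcases hgrow K with h | h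
  · exact h
  · have h1 : 1 ≤ (B 0).card := h0.card_pos
    have h2 := Finset.card_le_card (hmono K.zero_le)
    have h3 : Fintype.card V ≤ (B K).card := by exact_mod_cast hK.trans h
    lia

lemma sub_le_card_mul_of_forall_cut {δ : V → ℝ} {H : ℝ} (hH : 0 ≤ H)
    (hcut : ∀ A : Finset V, A.Nonempty → A ≠ Finset.univ → ∃ i ∈ A, ∃ j ∉ A, δ i - δ j ≤ H)
    (i j : V) : δ i - δ j ≤ Fintype.card V * H := by
  have hlevel (k : ℕ) : δ i - (k + 1 : ℕ) * H = δ i - k * H - H := by push_cast; ring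
  have hgrow (k : ℕ) : superlevel δ (δ i - k * H) = Finset.univ ∨
      k < (superlevel δ (δ i - k * H)).card := by
    induction k with
    | zero => exact Or.inr (Finset.card_pos.2 ⟨i, mem_superlevel.2 (by simp)⟩)
    | succ k ih =>
      have hmono := superlevel_antitone δ (show δ i - (k + 1 : ℕ) * H ≤ δ i - k * H by
        rw [hlevel]; linarith)
      by_cases huniv : superlevel δ (δ i - k * H) = Finset.univ
      · exact Or.inl (Finset.univ_subset_iff.1 (huniv ▸ hmono))
      obtain ⟨x, hx, y, hy, hxy⟩ := hcut _ ⟨i, mem_superlevel.2 (sub_le_self _ (by positivity))⟩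
        huniv
      have hy' : y ∈ superlevel δ (δ i - (k + 1 : ℕ) * H) := by
        rw [mem_superlevel] at hx ⊢
        linarith [hlevel k]
      have hlt := Finset.card_lt_card
        (Finset.ssubset_iff_subset_ne.2 ⟨hmono, fun h => hy (h ▸ hy')⟩)
      have := ih.resolve_left huniv
      exact Or.inr (by lia)
  have hj : j ∈ superlevel δ (δ i - Fintype.card V * H) := by
    rw [(hgrow (Fintype.card V)).resolve_right (Finset.card_le_univ _).not_gt]
    exact Finset.mem_univ j
  linarith [mem_superlevel.1 hj]

variable [DecidableEq V]

lemma cutWeight_compl_of_skew {γ : V → V → ℝ} (hγ : ∀ i j, γ j i = -γ i j) (A : Finset V) :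
    cutWeight γ A Aᶜ = ∑ i ∈ A, ∑ j, γ i j := by
  have hself : cutWeight γ A A = 0 := by linarith [cutWeight_swap_of_skew hγ A A]
  rw [← zero_add (cutWeight γ A Aᶜ), ← hself, cutWeight, cutWeight, ← Finset.sum_add_distrib]
  exact Finset.sum_congr rfl fun i _ => Finset.sum_add_sum_compl A _

lemma abs_cutWeight_compl_le {γ : V → V → ℝ} (hγ : ∀ i j, γ j i = -γ i j) {s : ℝ}
    (hs : ∀ i, |∑ j, γ i j| ≤ s) (A : Finset V) : |cutWeight γ A Aᶜ| ≤ s * A.card := by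
  rw [cutWeight_compl_of_skew hγ]
  refine (Finset.abs_sum_le_sum_abs _ _).trans ((Finset.sum_le_sum fun i _ => hs i).trans ?_)
  rw [Finset.sum_const, nsmul_eq_mul, mul_comm]

namespace IsDownwardFlow

variable {N γ : V → V → ℝ} {δ : V → ℝ} {a h r q s : ℝ}

lemma mul_cutWeight_le (H : IsDownwardFlow N δ a h γ) {A A' : Finset V} (hA : A ⊆ A')
    (hdown : ∀ i ∈ A, ∀ j ∉ A, δ j ≤ δ i) (hdrop : ∀ i ∈ A, ∀ j ∉ A', h ≤ δ i - δ j) :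
    a * cutWeight N A A'ᶜ ≤ cutWeight γ A Aᶜ := by
  simp only [cutWeight, Finset.mul_sum]
  refine Finset.sum_le_sum fun i hi => ?_
  calc ∑ j ∈ A'ᶜ, a * N i j ≤ ∑ j ∈ A'ᶜ, γ i j :=
        Finset.sum_le_sum fun j hj => H.mul_le i j (hdrop i hi j (Finset.mem_compl.1 hj))
    _ ≤ ∑ j ∈ Aᶜ, γ i j :=
        Finset.sum_le_sum_of_subset_of_nonneg (Finset.compl_subset_compl.2 hA) fun j hj _ =>
          H.nonneg i j (hdown i hi j (Finset.mem_compl.1 hj))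

lemma card_lt_two_mul_card_superlevel (H : IsDownwardFlow N δ a h γ) (ha : 0 < a) (hh : 0 ≤ h)
    (hexp : Expands N r q) (hr : 1 ≤ r) (hs : s ≤ a * q) (hγ : ∀ i, |∑ j, γ i j| ≤ s) {K : ℕ}
    (hK : (Fintype.card V : ℝ) ≤ r ^ K) (i₀ : V) :
    Fintype.card V < 2 * (superlevel δ (δ i₀ - K * h)).card := by
  have hlevel (k : ℕ) : δ i₀ - (k + 1 : ℕ) * h = δ i₀ - k * h - h := by push_cast; ring
  have hmono : Monotone fun k : ℕ => superlevel δ (δ i₀ - k * h) :=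
    monotone_nat_of_le_succ fun k => superlevel_antitone δ (by rw [hlevel]; linarith)
  have hmem (k : ℕ) : i₀ ∈ superlevel δ (δ i₀ - k * h) :=
    mem_superlevel.2 (sub_le_self _ (by positivity))
  refine card_lt_two_mul_card_of_growth hmono ⟨i₀, hmem 0⟩ hr (fun k => ?_) hK
  by_contra! hsmall
  have hout := hexp _ _ ⟨i₀, hmem k⟩ (hmono k.le_succ) hsmall.1 hsmall.2
  have hflow := H.mul_cutWeight_le (hmono k.le_succ)
    (fun i hi j hj => (not_le.1 (mt mem_superlevel.2 hj)).le.trans (mem_superlevel.1 hi))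
    fun i hi j hj => by
      have := mem_superlevel.1 hi
      have := not_le.1 (mt mem_superlevel.2 hj)
      linarith [hlevel k]
  have hsource := (le_abs_self _).trans
    (abs_cutWeight_compl_le H.skew hγ (superlevel δ (δ i₀ - k * h)))
  have hcap : s * (superlevel δ (δ i₀ - k * h)).card ≤
      a * q * (superlevel δ (δ i₀ - k * h)).card := by gcongr
  linarith [mul_lt_mul_of_pos_left hout ha]

lemma sub_le (H : IsDownwardFlow N δ a h γ) (hN : ∀ i j, N j i = N i j) (ha : 0 < a) (hh : 0 ≤ h)
    (hexp : Expands N r q) (hr : 1 ≤ r) (hs : s ≤ a * q) (hγ : ∀ i, |∑ j, γ i j| ≤ s) {K : ℕ}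
    (hK : (Fintype.card V : ℝ) ≤ r ^ K) (i j : V) : δ i - δ j ≤ 2 * K * h := by
  have habove := H.card_lt_two_mul_card_superlevel ha hh hexp hr hs hγ hK i
  have hbelow := (H.neg hN).card_lt_two_mul_card_superlevel ha hh hexp hr hs
    (by simpa only [Pi.neg_apply, Finset.sum_neg_distrib, abs_neg] using hγ) hK j
  obtain ⟨k, hk⟩ := Finset.inter_nonempty_of_card_lt_card_add_card (Finset.subset_univ _)
    (Finset.subset_univ _) (show (Finset.univ : Finset V).card <
      (superlevel δ (δ i - K * h)).card + (superlevel (-δ) ((-δ) j - K * h)).card by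
      rw [Finset.card_univ]; lia)
  simp only [Finset.mem_inter, mem_superlevel, Pi.neg_apply] at hk
  linarith

end IsDownwardFlow

lemma Expands.mul_card_lt_cutWeight_compl {N : V → V → ℝ} {r q : ℝ} (hexp : Expands N r q)
    (hN : ∀ i j, N j i = N i j) (hr : 1 ≤ r) {A : Finset V} (hA : A.Nonempty)
    (hA' : A ≠ Finset.univ) :
    q * A.card < cutWeight N A Aᶜ ∨ q * Aᶜ.card < cutWeight N A Aᶜ := by
  have hself (B : Finset V) : (B.card : ℝ) ≤ r * B.card := le_mul_of_one_le_left (by simp) hr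
  have hcard := A.card_add_card_compl
  rcases le_total A.card Aᶜ.card with h | h
  · exact Or.inl (hexp A A hA subset_rfl (by lia) (hself A))
  · have hAc := hexp Aᶜ Aᶜ (by simpa [Finset.nonempty_iff_ne_empty] using hA') subset_rfl
      (by lia) (hself Aᶜ)
    rw [compl_compl, cutWeight_comm hN] at hAc
    exact Or.inr hAc

lemma Expands.exists_lt_of_sum_le {N γ : V → V → ℝ} {r q a s : ℝ} (hexp : Expands N r q)
    (hN : ∀ i j, N j i = N i j) (hr : 1 ≤ r) (hγ : ∀ i j, γ j i = -γ i j)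
    (hsum : ∀ i, |∑ j, γ i j| ≤ s) (ha : 0 < a) (hs : s ≤ a * q) {A : Finset V} (hA : A.Nonempty)
    (hA' : A ≠ Finset.univ) : ∃ i ∈ A, ∃ j ∉ A, γ i j < a * N i j := by
  by_contra! hge
  have hcut : a * cutWeight N A Aᶜ ≤ cutWeight γ A Aᶜ := by
    simp only [cutWeight, Finset.mul_sum]
    exact Finset.sum_le_sum fun i hi => Finset.sum_le_sum fun j hj =>
      hge i hi j (Finset.mem_compl.1 hj)
  have hcap (B : Finset V) : s * B.card ≤ a * q * B.card :=
    mul_le_mul_of_nonneg_right hs (Nat.cast_nonneg _)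
  rcases hexp.mul_card_lt_cutWeight_compl hN hr hA hA' with h | h
  · have hout := (le_abs_self _).trans (abs_cutWeight_compl_le hγ hsum A)
    linarith [mul_lt_mul_of_pos_left h ha, hcap A]
  · have hin := (neg_le_abs _).trans (abs_cutWeight_compl_le hγ hsum Aᶜ)
    rw [compl_compl, cutWeight_swap_of_skew hγ A, neg_neg] at hin
    linarith [mul_lt_mul_of_pos_left h ha, hcap Aᶜ]

end Flows

/-! ### The likelihood equations -/

section Data

variable {n T : ℕ}

/-- The indices of the observed comparisons of `i` and `j`, symmetric in `i` and `j`. -/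
def observed (d : Data n T) (i j : Fin n) : Finset (Fin T) :=
  if h : i < j then Finset.univ.filter fun t => t.val < (d ⟨(i, j), h⟩).1
  else if h : j < i then Finset.univ.filter fun t => t.val < (d ⟨(j, i), h⟩).1
  else ∅

/-- The outcome of the comparison `t` of `i` and `j`, seen from `i`. -/
def outcome (d : Data n T) (i j : Fin n) (t : Fin T) : SignType :=
  if h : i < j then (d ⟨(i, j), h⟩).2 t
  else if h : j < i then -(d ⟨(j, i), h⟩).2 t
  else 0

/-- The number of observed comparisons of `i` and `j`. -/
def comparisonCount (d : Data n T) (i j : Fin n) : ℝ := (observed d i j).card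

/-- The total score of `i` in its observed comparisons with `j`, for the score vector `v`. -/
def totalScore (θ : ℝ) (d : Data n T) (v : Fin n → ℝ) (i j : Fin n) : ℝ :=
  ∑ t ∈ observed d i j, score θ (outcome d i j t) (v i - v j)

lemma observed_pair (d : Data n T) (e : Pair n) :
    observed d e.1.1 e.1.2 = Finset.univ.filter fun t => t.val < (d e).1 := by
  rw [observed, dif_pos e.2]

lemma outcome_pair (d : Data n T) (e : Pair n) (t : Fin T) :
    outcome d e.1.1 e.1.2 t = (d e).2 t := by
  rw [outcome, dif_pos e.2]

lemma observed_self (d : Data n T) (i : Fin n) : observed d i i = ∅ := by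
  simp [observed]

lemma observed_comm (d : Data n T) (i j : Fin n) : observed d j i = observed d i j := by
  rcases lt_trichotomy i j with h | rfl | h
  · simp [observed, h, h.not_gt]
  · rfl
  · simp [observed, h, h.not_gt]

lemma outcome_swap (d : Data n T) (i j : Fin n) (t : Fin T) :
    outcome d j i t = -outcome d i j t := by
  rcases lt_trichotomy i j with h | rfl | h
  · simp [outcome, h, h.not_gt]
  · simp [outcome]
  · simp [outcome, h, h.not_gt]

lemma comparisonCount_comm (d : Data n T) (i j : Fin n) :
    comparisonCount d j i = comparisonCount d i j := by
  rw [comparisonCount, observed_comm, comparisonCount]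

variable {θ : ℝ}

lemma totalScore_swap (d : Data n T) (v : Fin n → ℝ) (i j : Fin n) :
    totalScore θ d v j i = -totalScore θ d v i j := by
  simp only [totalScore, observed_comm d i j, outcome_swap d i j, ← neg_sub (v i), score_neg,
    Finset.sum_neg_distrib]

lemma mul_comparisonCount_le_sum {d : Data n T} {i j : Fin n} {a : ℝ} {f : Fin T → ℝ}
    (hf : ∀ t ∈ observed d i j, a ≤ f t) :
    a * comparisonCount d i j ≤ ∑ t ∈ observed d i j, f t := by
  rw [mul_comm, comparisonCount, ← nsmul_eq_mul]
  exact Finset.card_nsmul_le_sum _ _ _ hf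

lemma isDownwardFlow_totalScore_sub (hθ : 1 ≤ θ) (d : Data n T) {v : Fin n → ℝ} {M h : ℝ}
    (hM : ∀ i j, |v i - v j| ≤ M) (h0 : 0 ≤ h) (h1 : h ≤ 1) (w : Fin n → ℝ) :
    IsDownwardFlow (comparisonCount d) (w - v) (slope θ M * h) h
      (totalScore θ d v - totalScore θ d w) where
  skew i j := by
    simp only [Pi.sub_apply, totalScore_swap d v i j, totalScore_swap d w i j]
    ring
  nonneg i j hij := by
    simp only [Pi.sub_apply, totalScore, ← Finset.sum_sub_distrib] at hij ⊢
    exact Finset.sum_nonneg fun t _ => sub_nonneg.2 (score_antitone _ (by linarith))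
  mul_le i j hij := by
    simp only [Pi.sub_apply, totalScore, ← Finset.sum_sub_distrib] at hij ⊢
    exact mul_comparisonCount_le_sum fun t _ =>
      slope_mul_le_score_sub hθ _ (hM i j) h0 h1 (by linarith)

lemma logLikelihood_eq_sum (d : Data n T) (v : Fin n → ℝ) :
    logLikelihood θ d v = ∑ e : Pair n, ∑ t ∈ observed d e.1.1 e.1.2,
      Real.log (link θ (outcome d e.1.1 e.1.2 t) (v e.1.1 - v e.1.2)) := by
  simp only [logLikelihood, observed_pair, outcome_pair]

lemma hasDerivAt_logLikelihood (hθ : 1 < θ) (d : Data n T) (v w : Fin n → ℝ) :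
    HasDerivAt (fun s : ℝ => logLikelihood θ d (v + s • w))
      (∑ i, w i * ∑ j, totalScore θ d v i j) 0 := by
  rw [← sum_lt_mul_sub_eq_sum_mul_sum (totalScore_swap d v)]
  simp only [logLikelihood_eq_sum]
  refine HasDerivAt.fun_sum fun e _ => ?_
  rw [totalScore, Finset.sum_mul]
  refine HasDerivAt.fun_sum fun t _ => ?_
  have hline : HasDerivAt (fun s : ℝ => (v + s • w) e.1.1 - (v + s • w) e.1.2)
      (w e.1.1 - w e.1.2) 0 := by
    simpa using (((hasDerivAt_id (0 : ℝ)).mul_const (w e.1.1)).const_add (v e.1.1)).fun_sub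
      (((hasDerivAt_id (0 : ℝ)).mul_const (w e.1.2)).const_add (v e.1.2))
  have hlog := hasDerivAt_log_link hθ (outcome d e.1.1 e.1.2 t) (v e.1.1 - v e.1.2)
  exact HasDerivAt.comp (0 : ℝ) (by simpa using hlog) hline

lemma continuous_logLikelihood (hθ : 1 < θ) (d : Data n T) : Continuous (logLikelihood θ d) := by
  refine continuous_finsetSum _ fun e _ => continuous_finsetSum _ fun t _ => ?_
  have hlog : Continuous fun z => Real.log (link θ ((d e).2 t) z) :=
    continuous_iff_continuousAt.2 fun y => (hasDerivAt_log_link hθ _ y).continuousAt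
  exact hlog.comp (by fun_prop)

lemma logLikelihood_sub_const (d : Data n T) (v : Fin n → ℝ) (c : ℝ) :
    logLikelihood θ d (fun i => v i - c) = logLikelihood θ d v := by
  simp [logLikelihood]

lemma IsMLE.logLikelihood_le (hn : 0 < n) {d : Data n T} {v : Fin n → ℝ} (hv : IsMLE θ d v)
    (w : Fin n → ℝ) : logLikelihood θ d w ≤ logLikelihood θ d v := by
  rw [← logLikelihood_sub_const d w (w ⟨0, hn⟩)]
  refine hv.2 fun i hi => ?_
  rw [show i = ⟨0, hn⟩ from Fin.ext hi, sub_self]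

lemma IsMLE.sum_totalScore_eq_zero (hθ : 1 < θ) (hn : 0 < n) {d : Data n T} {v : Fin n → ℝ}
    (hv : IsMLE θ d v) (k : Fin n) : ∑ j, totalScore θ d v k j = 0 := by
  have hderiv := hasDerivAt_logLikelihood hθ d v (Pi.single k 1)
  have hmax : IsLocalMax (fun s : ℝ => logLikelihood θ d (v + s • Pi.single k 1)) 0 :=
    Eventually.of_forall fun s => by simpa using hv.logLikelihood_le hn _
  simpa [Pi.single_apply] using hmax.hasDerivAt_eq_zero hderiv

/-! ### Existence, uniqueness and stability of the maximum likelihood estimate -/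

/-- Ford's condition: for every splitting of the subjects into two nonempty classes, some subject of
the first class failed to win an observed comparison with a subject of the second. -/
def FordCondition (d : Data n T) : Prop :=
  ∀ A : Finset (Fin n), A.Nonempty → A ≠ Finset.univ →
    ∃ i ∈ A, ∃ j ∉ A, ∃ t ∈ observed d i j, outcome d i j t ≠ 1

lemma log_link_nonpos (hθ : 1 < θ) (x : SignType) (y : ℝ) : Real.log (link θ x y) ≤ 0 :=
  Real.log_nonpos (link_pos hθ x y).le (link_le_one hθ x y)

lemma logLikelihood_nonpos (hθ : 1 < θ) (d : Data n T) (v : Fin n → ℝ) :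
    logLikelihood θ d v ≤ 0 :=
  Finset.sum_nonpos fun _ _ => Finset.sum_nonpos fun _ _ => log_link_nonpos hθ _ _

lemma sum_le_of_forall_nonpos {ι : Type*} {s : Finset ι} {f : ι → ℝ} (hf : ∀ i ∈ s, f i ≤ 0)
    {i : ι} (hi : i ∈ s) : ∑ j ∈ s, f j ≤ f i := by
  simpa using Finset.single_le_sum (f := -f) (fun j hj => neg_nonneg.2 (hf j hj)) hi

lemma logLikelihood_le_log_link (hθ : 1 < θ) (d : Data n T) (v : Fin n → ℝ) {i j : Fin n}
    {t : Fin T} (ht : t ∈ observed d i j) :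
    logLikelihood θ d v ≤ Real.log (link θ (outcome d i j t) (v i - v j)) := by
  have hpair (e : Pair n) (he : t ∈ observed d e.1.1 e.1.2) :
      logLikelihood θ d v ≤ Real.log (link θ (outcome d e.1.1 e.1.2 t) (v e.1.1 - v e.1.2)) := by
    rw [logLikelihood_eq_sum]
    refine (sum_le_of_forall_nonpos (fun _ _ => ?_) (Finset.mem_univ e)).trans
      (sum_le_of_forall_nonpos (fun _ _ => log_link_nonpos hθ _ _) he)
    exact Finset.sum_nonpos fun _ _ => log_link_nonpos hθ _ _
  rcases lt_trichotomy i j with h | rfl | h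
  · exact hpair ⟨(i, j), h⟩ ht
  · simp [observed_self] at ht
  · rw [← link_neg (by linarith), ← outcome_swap, neg_sub]
    exact hpair ⟨(j, i), h⟩ (by rwa [observed_comm])

lemma FordCondition.sub_le (hθ : 1 < θ) {d : Data n T} (hd : FordCondition d) (v : Fin n → ℝ)
    (i j : Fin n) : v i - v j ≤ n * (Real.log θ - logLikelihood θ d v) := by
  have hH : 0 ≤ Real.log θ - logLikelihood θ d v :=
    sub_nonneg.2 ((logLikelihood_nonpos hθ d v).trans (Real.log_nonneg hθ.le))
  have h := sub_le_card_mul_of_forall_cut (δ := v) hH (fun A hA hA' => ?_) i j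
  · rwa [Fintype.card_fin] at h
  obtain ⟨i, hi, j, hj, t, ht, hne⟩ := hd A hA hA'
  have h1 := logLikelihood_le_log_link hθ d v ht
  have h2 := log_link_le_of_ne_one hθ hne (v i - v j)
  exact ⟨i, hi, j, hj, by linarith⟩

lemma sub_mem_normalized {v w : Fin n → ℝ} (hv : v ∈ normalized n) (hw : w ∈ normalized n) :
    v - w ∈ normalized n := fun i hi => by
  rw [Pi.sub_apply, hv i hi, hw i hi, sub_self]

lemma norm_le_of_forall_sub_le (hn : 0 < n) {v : Fin n → ℝ} (hv : v ∈ normalized n) {c : ℝ}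
    (hc : ∀ i j, v i - v j ≤ c) : ‖v‖ ≤ c := by
  have hv0 : v ⟨0, hn⟩ = 0 := hv _ rfl
  have hc0 : 0 ≤ c := by simpa using hc ⟨0, hn⟩ ⟨0, hn⟩
  refine (pi_norm_le_iff_of_nonneg hc0).2 fun i => abs_le.2 ⟨?_, ?_⟩
  · linarith [hc ⟨0, hn⟩ i]
  · linarith [hc i ⟨0, hn⟩]

lemma isClosed_normalized : IsClosed (normalized n) := by
  simp only [normalized, Set.ofPred_forall]
  exact isClosed_iInter fun i => isClosed_iInter fun _ =>
    isClosed_eq (continuous_apply i) continuous_const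

lemma FordCondition.exists_isMLE (hθ : 1 < θ) (hn : 0 < n) {d : Data n T} (hd : FordCondition d) :
    ∃ v, IsMLE θ d v := by
  have hcompact := isCompact_closedBall (0 : Fin n → ℝ) (n * (Real.log θ - logLikelihood θ d 0))
  refine (continuous_logLikelihood hθ d).continuousOn.exists_isMaxOn' isClosed_normalized
    (x₀ := 0) (fun _ _ => rfl) (eventually_inf_principal.2 ?_)
  filter_upwards [hcompact.compl_mem_cocompact] with w hw hwn
  contrapose! hw
  rw [Set.notMem_compl_iff, mem_closedBall_zero_iff]
  refine norm_le_of_forall_sub_le hn hwn fun i j => (hd.sub_le hθ w i j).trans ?_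
  gcongr

lemma fordCondition_of_expands (hθ : 1 ≤ θ) {d : Data n T} {u : Fin n → ℝ} {M r q s : ℝ}
    (hM : ∀ i j, |u i - u j| ≤ M) (hexp : Expands (comparisonCount d) r q) (hr : 1 ≤ r)
    (hs : s ≤ slope θ M * q) (hu : ∀ i, |∑ j, totalScore θ d u i j| ≤ s) : FordCondition d := by
  intro A hA hA'
  obtain ⟨i, hi, j, hj, hlt⟩ := hexp.exists_lt_of_sum_le (comparisonCount_comm d) hr
    (totalScore_swap d u) hu (slope_pos (by linarith) M) hs hA hA'
  refine ⟨i, hi, j, hj, ?_⟩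
  by_contra! hwin
  refine hlt.not_ge (mul_comparisonCount_le_sum fun t ht => ?_)
  rw [hwin t ht]
  exact slope_le_score_one hθ (hM i j)

lemma norm_sub_le_of_expands (hθ : 1 ≤ θ) (hn : 0 < n) {d : Data n T} {v w : Fin n → ℝ}
    (hv : v ∈ normalized n) (hw : w ∈ normalized n) {M h r q s : ℝ} {K : ℕ}
    (hM : ∀ i j, |v i - v j| ≤ M) (h0 : 0 < h) (h1 : h ≤ 1) (hr : 1 ≤ r)
    (hK : (n : ℝ) ≤ r ^ K) (hexp : Expands (comparisonCount d) r q)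
    (hs : s ≤ slope θ M * h * q)
    (hsum : ∀ i, |∑ j, totalScore θ d v i j - ∑ j, totalScore θ d w i j| ≤ s) :
    ‖w - v‖ ≤ 2 * K * h := by
  refine norm_le_of_forall_sub_le hn (sub_mem_normalized hw hv) fun i j => ?_
  refine (isDownwardFlow_totalScore_sub hθ d hM h0.le h1 w).sub_le (comparisonCount_comm d)
    (mul_pos (slope_pos (by linarith) M) h0) h0.le hexp hr hs (fun i => ?_) ?_ i j
  · simpa only [Pi.sub_apply, Finset.sum_sub_distrib] using hsum i
  · rwa [Fintype.card_fin]

lemma abs_sub_le_dynamicRange (u : Fin n → ℝ) (i j : Fin n) : |u i - u j| ≤ dynamicRange u :=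
  le_ciSup (f := fun e : Fin n × Fin n => |u e.1 - u e.2|) (Set.finite_range _).bddAbove (i, j)

lemma IsMLE.eq_of_expands (hθ : 1 < θ) (hn : 0 < n) {d : Data n T} {v w : Fin n → ℝ}
    (hv : IsMLE θ d v) (hw : IsMLE θ d w) {r q : ℝ} {K : ℕ} (hr : 1 ≤ r) (hq : 0 ≤ q)
    (hK : (n : ℝ) ≤ r ^ K) (hexp : Expands (comparisonCount d) r q) : w = v := by
  have hle {h : ℝ} (h0 : 0 < h) (h1 : h ≤ 1) : ‖w - v‖ ≤ 2 * K * h := by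
    have hslope := slope_pos (by linarith : 0 < θ) (dynamicRange v)
    refine norm_sub_le_of_expands hθ.le hn hv.1 hw.1 (abs_sub_le_dynamicRange v) h0 h1 hr hK hexp
      (s := 0) (by positivity) fun i => ?_
    rw [hv.sum_totalScore_eq_zero hθ hn, hw.sum_totalScore_eq_zero hθ hn, sub_zero, abs_zero]
  have hlim : Tendsto (fun h : ℝ => 2 * K * h) (𝓝[>] 0) (𝓝 0) := by
    simpa using ((continuous_const_mul (2 * K : ℝ)).tendsto 0).mono_left nhdsWithin_le_nhds
  refine sub_eq_zero.1 (norm_le_zero_iff.1 (ge_of_tendsto hlim ?_))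
  filter_upwards [Ioc_mem_nhdsGT zero_lt_one] with h hh
  exact hle hh.1 hh.2

theorem exists_unique_isMLE_of_expands (hθ : 1 < θ) (hn : 0 < n) {d : Data n T} {u : Fin n → ℝ}
    (hu : u ∈ normalized n) {h r q s : ℝ} {K : ℕ} (h0 : 0 < h) (h1 : h ≤ 1) (hr : 1 ≤ r)
    (hq : 0 ≤ q) (hs : s ≤ slope θ (dynamicRange u) * h * q) (hK : (n : ℝ) ≤ r ^ K)
    (hexp : Expands (comparisonCount d) r q) (hscore : ∀ i, |∑ j, totalScore θ d u i j| ≤ s) :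
    ∃ v, IsMLE θ d v ∧ (∀ w, IsMLE θ d w → w = v) ∧ ‖v - u‖ ≤ 2 * K * h := by
  have hslope := (slope_pos (by linarith : 0 < θ) (dynamicRange u)).le
  have hford := fordCondition_of_expands hθ.le (abs_sub_le_dynamicRange u) hexp hr
    (hs.trans (mul_le_mul_of_nonneg_right (mul_le_of_le_one_right hslope h1) hq)) hscore
  obtain ⟨v, hv⟩ := hford.exists_isMLE hθ hn
  refine ⟨v, hv, fun w hw => hv.eq_of_expands hθ hn hw hr hq hK hexp,
    norm_sub_le_of_expands hθ.le hn hu hv.1 (abs_sub_le_dynamicRange u) h0 h1 hr hK hexp hs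
      fun i => ?_⟩
  rw [hv.sum_totalScore_eq_zero hθ hn, sub_zero]
  exact hscore i

end Data

/-! ### Exponential tail bounds -/

section Chernoff

lemma exp_neg_le_one_sub_half {w : ℝ} (h0 : 0 ≤ w) (h1 : w ≤ 1) : Real.exp (-w) ≤ 1 - w / 2 := by
  rw [Real.exp_neg, inv_le_comm₀ (Real.exp_pos w) (by linarith)]
  refine le_trans ?_ (Real.add_one_le_exp w)
  rw [inv_le_iff_one_le_mul₀ (by linarith)]
  nlinarith

lemma measureReal_pi_le_sum_le_exp_mul_prod {ι : Type*} [Fintype ι] {E : ι → Type*}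
    [∀ i, MeasurableSpace (E i)] (μ : ∀ i, Measure (E i)) [∀ i, IsProbabilityMeasure (μ i)]
    {g : ∀ i, E i → ℝ} (hg : ∀ i, Integrable (fun x => Real.exp (g i x)) (μ i)) (c : ℝ) :
    (Measure.pi μ).real {x | c ≤ ∑ i, g i (x i)} ≤
      Real.exp (-c) * ∏ i, ∫ x, Real.exp (g i x) ∂μ i := by
  have hint : Integrable (fun x : ∀ i, E i => Real.exp (1 * ∑ i, g i (x i))) (Measure.pi μ) := by
    simpa only [one_mul, Real.exp_sum] using Integrable.fintype_prod_dep hg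
  have hmgf : mgf (fun x : ∀ i, E i => ∑ i, g i (x i)) (Measure.pi μ) 1 =
      ∏ i, ∫ x, Real.exp (g i x) ∂μ i := by
    simp only [mgf, one_mul, Real.exp_sum]
    exact integral_fintype_prod_eq_prod fun i x => Real.exp (g i x)
  simpa only [neg_one_mul, hmgf] using measure_ge_le_exp_mul_mgf c zero_le_one hint

variable {α : Type*} [MeasurableSpace α] {T : ℕ} (p : unitInterval)
  (ν : Measure α) [IsProbabilityMeasure ν]

lemma integral_pow_card_lt_binomial (m : ℝ) :
    ∫ k, m ^ (Finset.univ.filter fun t : Fin T => t.val < k).card ∂binomial T p =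
      (1 - p + p * m) ^ T := by
  rw [integral_binomial, add_comm (1 - (p : ℝ)), add_pow, Nat.range_succ_eq_Iic]
  refine Finset.sum_congr rfl fun k hk => ?_
  rw [Fin.card_filter_val_lt, min_eq_right (Finset.mem_Iic.1 hk), mul_pow, smul_eq_mul]
  ring

lemma integral_exp_sum_lt_pi (f : α → ℝ) (k : ℕ) :
    ∫ x : Fin T → α, Real.exp (∑ t with t.val < k, f (x t)) ∂Measure.pi (fun _ => ν) =
      (∫ x, Real.exp (f x) ∂ν) ^ (Finset.univ.filter fun t : Fin T => t.val < k).card := by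
  simp only [Real.exp_sum, Finset.prod_filter]
  rw [integral_fintype_prod_eq_prod
    fun (t : Fin T) (x : α) => if t.val < k then Real.exp (f x) else 1,
    ← Finset.prod_const, Finset.prod_filter]
  refine Finset.prod_congr rfl fun t _ => ?_
  split_ifs
  · rfl
  · simp

variable [Finite α] [DiscreteMeasurableSpace α]

lemma integrable_exp_sum_lt_binomial (f : α → ℝ) :
    Integrable (fun z : ℕ × (Fin T → α) => Real.exp (∑ t with t.val < z.1, f (z.2 t)))
      ((binomial T p).prod (Measure.pi fun _ => ν)) := by
  have hdom : Integrable (fun x : Fin T → α => Real.exp (∑ t, |f (x t)|))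
      (Measure.pi fun _ => ν) := .of_finite
  refine (hdom.comp_snd (binomial T p)).mono' Measurable.of_discrete.aestronglyMeasurable
    (Eventually.of_forall fun z => ?_)
  rw [Real.norm_of_nonneg (Real.exp_pos _).le]
  gcongr
  calc ∑ t with t.val < z.1, f (z.2 t)
      ≤ ∑ t with t.val < z.1, |f (z.2 t)| := Finset.sum_le_sum fun _ _ => le_abs_self _
    _ ≤ ∑ t, |f (z.2 t)| :=
        Finset.sum_le_univ_sum_of_nonneg fun _ => abs_nonneg _

lemma integral_exp_sum_lt_binomial (f : α → ℝ) :
    ∫ z : ℕ × (Fin T → α), Real.exp (∑ t with t.val < z.1, f (z.2 t))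
      ∂(binomial T p).prod (Measure.pi fun _ => ν) =
      (1 - p + p * ∫ x, Real.exp (f x) ∂ν) ^ T := by
  rw [integral_prod _ (integrable_exp_sum_lt_binomial p ν f)]
  simp only [integral_exp_sum_lt_pi, integral_pow_card_lt_binomial]

end Chernoff

section OutcomeLaw

variable {θ : ℝ}

lemma isProbabilityMeasure_outcomeLaw (hθ : 1 < θ) (y : ℝ) :
    IsProbabilityMeasure (outcomeLaw θ y) := by
  constructor
  simp only [outcomeLaw, Measure.finsetSum_apply, Measure.smul_apply, measure_univ, smul_eq_mul,
    mul_one]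
  rw [← ENNReal.ofReal_sum_of_nonneg fun x _ => (link_pos hθ x y).le,
    sum_link (zero_lt_one.trans hθ), ENNReal.ofReal_one]

lemma integral_outcomeLaw (hθ : 1 < θ) (y : ℝ) (f : SignType → ℝ) :
    ∫ x, f x ∂outcomeLaw θ y = ∑ x, link θ x y * f x := by
  rw [outcomeLaw,
    integral_finsetSum_measure fun x _ => Integrable.of_finite.smul_measure ENNReal.ofReal_ne_top]
  refine Finset.sum_congr rfl fun x _ => ?_
  rw [integral_smul_measure, integral_dirac, ENNReal.toReal_ofReal (link_pos hθ x y).le,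
    smul_eq_mul]

lemma integral_score_outcomeLaw (hθ : 1 < θ) (y : ℝ) :
    ∫ x, score θ x y ∂outcomeLaw θ y = 0 := by
  rw [integral_outcomeLaw hθ, sum_link_mul_score (zero_lt_one.trans hθ)]

lemma integral_exp_mul_score_le (hθ : 1 < θ) (y : ℝ) {τ : ℝ} (hτ : |τ| ≤ 1) :
    ∫ x, Real.exp (τ * score θ x y) ∂outcomeLaw θ y ≤ 1 + τ ^ 2 := by
  have := isProbabilityMeasure_outcomeLaw hθ y
  have hexp (x : SignType) : Real.exp (τ * score θ x y) ≤ 1 + τ * score θ x y + τ ^ 2 := by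
    have hs := abs_score_le_one (θ := θ) x y
    have hτs : |τ * score θ x y| ≤ 1 := by
      rw [abs_mul]
      exact mul_le_one₀ hτ (abs_nonneg _) hs
    have hsq : (τ * score θ x y) ^ 2 ≤ τ ^ 2 := by
      rw [mul_pow]
      exact mul_le_of_le_one_right (sq_nonneg _) ((sq_le_one_iff_abs_le_one _).2 hs)
    linarith [(abs_le.1 (Real.abs_exp_sub_one_sub_id_le hτs)).2]
  calc ∫ x, Real.exp (τ * score θ x y) ∂outcomeLaw θ y
      ≤ ∫ x, (1 + τ * score θ x y + τ ^ 2) ∂outcomeLaw θ y :=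
        integral_mono .of_finite .of_finite hexp
    _ = 1 + τ ^ 2 := by
        rw [integral_add .of_finite .of_finite, integral_add .of_finite .of_finite,
          integral_const_mul, integral_score_outcomeLaw hθ]
        simp

lemma isProbabilityMeasure_dataLaw (hθ : 1 < θ) (T : ℕ) (p : unitInterval) {n : ℕ}
    (u : Fin n → ℝ) : IsProbabilityMeasure (dataLaw θ T p u) := by
  have := isProbabilityMeasure_outcomeLaw hθ
  unfold dataLaw
  infer_instance

end OutcomeLaw

section DataLaw

variable {θ : ℝ} {n T : ℕ} {p : unitInterval} {u : Fin n → ℝ}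

lemma dataLaw_real_le_exp_mul_prod (hθ : 1 < θ) (φ : Pair n → SignType → ℝ) (c : ℝ) :
    (dataLaw θ T p u).real {d | c ≤ ∑ e, ∑ t with t.val < (d e).1, φ e ((d e).2 t)} ≤
      Real.exp (-c) * ∏ e : Pair n,
        (1 - p + p * ∫ x, Real.exp (φ e x) ∂outcomeLaw θ (u e.1.1 - u e.1.2)) ^ T := by
  have := isProbabilityMeasure_outcomeLaw hθ
  simp_rw [← integral_exp_sum_lt_binomial]
  exact measureReal_pi_le_sum_le_exp_mul_prod _
    (fun e => integrable_exp_sum_lt_binomial p _ (φ e)) c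

lemma dataLaw_real_le_sum_observed_le (hθ : 1 < θ) {φ : Pair n → SignType → ℝ} {a : Pair n → ℝ}
    (hφ : ∀ e : Pair n,
      ∫ x, Real.exp (φ e x) ∂outcomeLaw θ (u e.1.1 - u e.1.2) ≤ 1 + a e) (c : ℝ) :
    (dataLaw θ T p u).real {d | c ≤ ∑ e : Pair n, ∑ t ∈ observed d e.1.1 e.1.2,
      φ e (outcome d e.1.1 e.1.2 t)} ≤ Real.exp (T * p * ∑ e, a e - c) := by
  have hbase (e : Pair n) :
      0 ≤ 1 - p + p * ∫ x, Real.exp (φ e x) ∂outcomeLaw θ (u e.1.1 - u e.1.2) :=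
    add_nonneg (unitInterval.one_minus_nonneg p) <| mul_nonneg (unitInterval.nonneg p) <|
      integral_nonneg fun _ => (Real.exp_pos _).le
  have hfactor (e : Pair n) :
      1 - p + p * ∫ x, Real.exp (φ e x) ∂outcomeLaw θ (u e.1.1 - u e.1.2) ≤
        Real.exp (p * a e) := by
    linarith [mul_le_mul_of_nonneg_left (hφ e) (unitInterval.nonneg p),
      Real.add_one_le_exp ((p : ℝ) * a e)]
  simp only [observed_pair, outcome_pair]
  calc (dataLaw θ T p u).real {d | c ≤ ∑ e, ∑ t with t.val < (d e).1, φ e ((d e).2 t)}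
      ≤ Real.exp (-c) * ∏ e : Pair n,
          (1 - p + p * ∫ x, Real.exp (φ e x) ∂outcomeLaw θ (u e.1.1 - u e.1.2)) ^ T :=
        dataLaw_real_le_exp_mul_prod hθ φ c
    _ ≤ Real.exp (-c) * ∏ e : Pair n, Real.exp (p * a e) ^ T :=
        mul_le_mul_of_nonneg_left
          (Finset.prod_le_prod (fun e _ => pow_nonneg (hbase e) T)
            fun e _ => pow_le_pow_left₀ (hbase e) (hfactor e) T)
          (Real.exp_pos _).le
    _ = Real.exp (T * p * ∑ e, a e - c) := by
        simp only [← Real.exp_nat_mul]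
        rw [← Real.exp_sum, ← Real.exp_add, ← Finset.mul_sum, ← Finset.mul_sum, mul_assoc,
          neg_add_eq_sub]

lemma dataLaw_real_sum_mul_comparisonCount_le (hθ : 1 < θ) (hT : 1 ≤ T) {w : Pair n → ℝ}
    (hw0 : ∀ e, 0 ≤ w e) (hw1 : ∀ e, w e ≤ 1) (c : ℝ) :
    (dataLaw θ T p u).real {d | ∑ e, w e * comparisonCount d e.1.1 e.1.2 ≤ c} ≤
      Real.exp (c - p / 2 * ∑ e, w e) := by
  have := isProbabilityMeasure_outcomeLaw hθ
  have htail := dataLaw_real_le_sum_observed_le (T := T) (p := p) (u := u) hθ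
    (φ := fun e _ => -w e) (a := fun e => -(w e / 2))
    (fun e => by
      rw [integral_const, probReal_univ, one_smul, ← sub_eq_add_neg]
      exact exp_neg_le_one_sub_half (hw0 e) (hw1 e)) (-c)
  have hset (d : Data n T) : -c ≤ ∑ e : Pair n, ∑ _t ∈ observed d e.1.1 e.1.2, -w e ↔
      ∑ e, w e * comparisonCount d e.1.1 e.1.2 ≤ c := by
    simp [comparisonCount, mul_comm (w _)]
  simp only [hset] at htail
  refine htail.trans (Real.exp_le_exp.2 ?_)
  have hmean : (0 : ℝ) ≤ p / 2 * ∑ e, w e :=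
    mul_nonneg (div_nonneg p.2.1 zero_le_two) (Finset.sum_nonneg fun e _ => hw0 e)
  have hT' : (1 : ℝ) ≤ T := by exact_mod_cast hT
  rw [Finset.sum_neg_distrib, ← Finset.sum_div]
  nlinarith

lemma dataLaw_real_le_sum_mul_totalScore (hθ : 1 < θ) {w : Pair n → ℝ} (hw : ∀ e, |w e| ≤ 1)
    (s : ℝ) :
    (dataLaw θ T p u).real {d | s ≤ ∑ e, w e * totalScore θ d u e.1.1 e.1.2} ≤
      Real.exp (T * p * ∑ e, w e ^ 2 - s) := by
  have htail := dataLaw_real_le_sum_observed_le (T := T) (p := p) hθ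
    (fun e => integral_exp_mul_score_le hθ (u e.1.1 - u e.1.2) (hw e)) s
  simpa only [totalScore, Finset.mul_sum (s := observed _ _ _)] using htail

/-- The indicator of the pairs with one subject in each of two sets. -/
def crossing (A B : Finset (Fin n)) (e : Pair n) : ℝ :=
  if e.1.1 ∈ A ∧ e.1.2 ∈ B ∨ e.1.2 ∈ A ∧ e.1.1 ∈ B then 1 else 0

lemma cutWeight_eq_sum_crossing {N : Fin n → Fin n → ℝ} (hN : ∀ i j, N j i = N i j)
    {A B : Finset (Fin n)} (hAB : Disjoint A B) :
    cutWeight N A B = ∑ e : Pair n, crossing A B e * N e.1.1 e.1.2 := by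
  have hne {i : Fin n} (hi : i ∈ A) : i ∉ B := Finset.disjoint_left.1 hAB hi
  have hsum : cutWeight N A B = ∑ i, ∑ j, if i ∈ A ∧ j ∈ B then N i j else 0 := by
    simp only [cutWeight, ite_and, Finset.sum_ite_mem, Finset.univ_inter, Finset.sum_ite_irrel,
      Finset.sum_const_zero]
  have hdiag (i : Fin n) : (if i ∈ A ∧ i ∈ B then N i i else 0) = 0 :=
    if_neg fun h => hne h.1 h.2
  rw [hsum, sum_sum_eq_sum_lt_add_sum_diag]
  simp only [hdiag, Finset.sum_const_zero, add_zero]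
  refine Finset.sum_congr rfl fun e _ => ?_
  rw [crossing, hN e.1.1 e.1.2]
  by_cases h1 : e.1.1 ∈ A <;> by_cases h2 : e.1.2 ∈ A <;>
    simp [h1, h2, hne]

lemma dataLaw_real_cutWeight_le (hθ : 1 < θ) (hT : 1 ≤ T) {A B : Finset (Fin n)}
    (hAB : Disjoint A B) (c : ℝ) :
    (dataLaw θ T p u).real {d | cutWeight (comparisonCount d) A B ≤ c} ≤
      Real.exp (c - p / 2 * (A.card * B.card)) := by
  have hcard : (A.card * B.card : ℝ) = ∑ e, crossing A B e := by
    simpa [cutWeight] using cutWeight_eq_sum_crossing (N := fun _ _ => 1) (fun _ _ => rfl) hAB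
  simp only [cutWeight_eq_sum_crossing (comparisonCount_comm _) hAB, hcard]
  refine dataLaw_real_sum_mul_comparisonCount_le hθ hT (fun e => ?_) (fun e => ?_) c <;>
    · rw [crossing]
      split_ifs <;> norm_num

/-- The signed incidence of a subject and a pair: `1` or `-1` if the subject is the first or the
second of the pair, and `0` otherwise. -/
def incidence (i : Fin n) (e : Pair n) : ℝ :=
  (if e.1.1 = i then 1 else 0) - if e.1.2 = i then 1 else 0

lemma sum_eq_sum_incidence_mul {γ : Fin n → Fin n → ℝ} (hγ : ∀ i j, γ j i = -γ i j) (i : Fin n) :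
    ∑ j, γ i j = ∑ e, incidence i e * γ e.1.1 e.1.2 := by
  have hrow : ∑ j, γ i j = ∑ a, ∑ b, if a = i then γ a b else 0 := by
    simp [Finset.sum_ite_irrel]
  have hdiag (a : Fin n) : (if a = i then γ a a else 0) = 0 := by
    rw [self_eq_neg.1 (hγ a a), ite_self]
  rw [hrow, sum_sum_eq_sum_lt_add_sum_diag]
  simp only [hdiag, Finset.sum_const_zero, add_zero]
  refine Finset.sum_congr rfl fun e _ => ?_
  rw [incidence, hγ e.1.1 e.1.2]
  split_ifs <;> ring

lemma abs_incidence_le_one (i : Fin n) (e : Pair n) : |incidence i e| ≤ 1 := by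
  rw [incidence]
  split_ifs <;> norm_num

lemma sum_incidence_sq_le (i : Fin n) : ∑ e, incidence i e ^ 2 ≤ n := by
  have hcount : (n : ℝ) =
      ∑ e : Pair n, ((if e.1.1 = i then 1 else 0) + if e.1.2 = i then 1 else 0) + 1 := by
    simpa [Finset.sum_ite_irrel] using
      sum_sum_eq_sum_lt_add_sum_diag fun a _ : Fin n => if a = i then (1 : ℝ) else 0
  have hsq (e : Pair n) : incidence i e ^ 2 ≤
      (if e.1.1 = i then 1 else 0) + if e.1.2 = i then 1 else 0 := by
    rw [incidence]
    split_ifs <;> norm_num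
  have hle := Finset.sum_le_sum fun e (_ : e ∈ Finset.univ) => hsq e
  linarith

lemma dataLaw_real_le_mul_sum_totalScore (hθ : 1 < θ) {τ : ℝ} (hτ : |τ| ≤ 1) (i : Fin n) (s : ℝ) :
    (dataLaw θ T p u).real {d | s ≤ τ * ∑ j, totalScore θ d u i j} ≤
      Real.exp (T * τ ^ 2 * (n * p) - s) := by
  have htail := dataLaw_real_le_sum_mul_totalScore (T := T) (p := p) (u := u) hθ
    (w := fun e => τ * incidence i e)
    (fun e => by
      rw [abs_mul]
      exact mul_le_one₀ hτ (abs_nonneg _) (abs_incidence_le_one i e)) s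
  simp only [mul_assoc, ← Finset.mul_sum, mul_pow,
    ← sum_eq_sum_incidence_mul (totalScore_swap _ u)] at htail
  refine htail.trans (Real.exp_le_exp.2 (sub_le_sub_right ?_ s))
  have hp := unitInterval.nonneg p
  calc (T : ℝ) * (p * (τ ^ 2 * ∑ e, incidence i e ^ 2)) ≤ T * (p * (τ ^ 2 * n)) := by
        gcongr
        exact sum_incidence_sq_le i
    _ = T * τ ^ 2 * (n * p) := by ring

end DataLaw

section UnionBounds

variable {θ : ℝ} {n T : ℕ} {p : unitInterval} {u : Fin n → ℝ}

lemma sum_inv_pow_card_le (hn : 0 < n) : ∑ A : Finset (Fin n), (n : ℝ)⁻¹ ^ A.card ≤ 3 := by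
  have hbinomial := Fin.sum_pow_mul_eq_add_pow (n := n) (n : ℝ)⁻¹ 1
  simp only [one_pow, mul_one] at hbinomial
  calc ∑ A : Finset (Fin n), (n : ℝ)⁻¹ ^ A.card = ((n : ℝ)⁻¹ + 1) ^ n := hbinomial
    _ ≤ Real.exp (n : ℝ)⁻¹ ^ n := by
        gcongr
        exact Real.add_one_le_exp _
    _ = Real.exp 1 := by rw [← Real.exp_nat_mul, mul_inv_cancel₀ (by positivity)]
    _ ≤ 3 := Real.exp_one_lt_three.le

lemma exp_neg_mul_log (hn : 0 < n) (k : ℕ) :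
    Real.exp (-(k * Real.log n)) = (n : ℝ)⁻¹ ^ k := by
  rw [Real.exp_neg, Real.exp_nat_mul, Real.exp_log (by exact_mod_cast hn), inv_pow]

lemma dataLaw_real_cutWeight_compl_le (hθ : 1 < θ) (hT : 1 ≤ T) (hn : 2 ≤ n)
    (hp : 64 * Real.log n ≤ n * p) {A A' : Finset (Fin n)} (hA : A.Nonempty) (hAA' : A ⊆ A')
    (hA' : 2 * A'.card ≤ n)
    (hcard : (A'.card : ℝ) ≤ n * p / (64 * Real.log n) * A.card) :
    (dataLaw θ T p u).real {d | cutWeight (comparisonCount d) A A'ᶜ ≤ n * p / 8 * A.card} ≤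
      (n : ℝ)⁻¹ ^ 3 * ((n : ℝ)⁻¹ ^ A.card * (n : ℝ)⁻¹ ^ A'.card) := by
  have hL : 0 < Real.log n := Real.log_pos (by exact_mod_cast hn)
  have hA1 : (1 : ℝ) ≤ A.card := by exact_mod_cast hA.card_pos
  have hcompl : (n : ℝ) / 2 ≤ A'ᶜ.card := by
    have h2A' : 2 * (A'.card : ℝ) ≤ n := by exact_mod_cast hA'
    rw [Finset.card_compl, Fintype.card_fin, Nat.cast_sub (by lia)]
    linarith
  have hmean : (n : ℝ) * p / 4 * A.card ≤ p / 2 * (A.card * A'ᶜ.card) := by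
    have hp0 := unitInterval.nonneg p
    calc (n : ℝ) * p / 4 * A.card = (p : ℝ) / 2 * (A.card * (n / 2)) := by ring
      _ ≤ p / 2 * (A.card * A'ᶜ.card) := by gcongr
  have hlogA' : A'.card * Real.log n ≤ n * p / 64 * A.card := by
    calc A'.card * Real.log n ≤ n * p / (64 * Real.log n) * A.card * Real.log n := by gcongr
      _ = n * p / 64 * A.card := by field_simp
  have hlogA : A.card * Real.log n ≤ n * p / 64 * A.card := by
    rw [mul_comm]
    gcongr
    linarith
  have hlog : Real.log n ≤ A.card * Real.log n := le_mul_of_one_le_left hL.le hA1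
  refine (dataLaw_real_cutWeight_le hθ hT (disjoint_compl_right.mono_left hAA') _).trans ?_
  simp only [← exp_neg_mul_log (zero_lt_two.trans_le hn), ← Real.exp_add]
  gcongr
  push_cast
  linarith

lemma dataLaw_real_not_expands_le (hθ : 1 < θ) (hT : 1 ≤ T) (hn : 2 ≤ n)
    (hp : 64 * Real.log n ≤ n * p) :
    (dataLaw θ T p u).real
      {d | ¬ Expands (comparisonCount d) (n * p / (64 * Real.log n)) (n * p / 8)} ≤
        9 / (n : ℝ) ^ 3 := by
  have := isProbabilityMeasure_dataLaw hθ T p u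
  set S : Finset (Finset (Fin n) × Finset (Fin n)) := {Q | Q.1.Nonempty ∧ Q.1 ⊆ Q.2 ∧
    2 * Q.2.card ≤ n ∧ (Q.2.card : ℝ) ≤ n * p / (64 * Real.log n) * Q.1.card} with hS
  have hsub : {d : Data n T |
      ¬ Expands (comparisonCount d) (n * p / (64 * Real.log n)) (n * p / 8)} ⊆
      ⋃ Q ∈ S, {d | cutWeight (comparisonCount d) Q.1 Q.2ᶜ ≤ n * p / 8 * Q.1.card} := by
    intro d hd
    simp only [Set.mem_ofPred_eq, Expands, not_forall, not_lt, Fintype.card_fin] at hd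
    obtain ⟨A, A', hA, hAA', hA', hcard, hcut⟩ := hd
    exact Set.mem_biUnion (x := (A, A')) (by simp [hS, hA, hAA', hA', hcard]) hcut
  have hsum := sum_inv_pow_card_le (n := n) (by lia)
  calc _ ≤ ∑ Q ∈ S, (dataLaw θ T p u).real
          {d | cutWeight (comparisonCount d) Q.1 Q.2ᶜ ≤ n * p / 8 * Q.1.card} :=
        (measureReal_mono hsub (measure_ne_top _ _)).trans (measureReal_biUnion_finset_le _ _)
    _ ≤ ∑ Q ∈ S, (n : ℝ)⁻¹ ^ 3 * ((n : ℝ)⁻¹ ^ Q.1.card * (n : ℝ)⁻¹ ^ Q.2.card) := by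
        refine Finset.sum_le_sum fun Q hQ => ?_
        obtain ⟨hA, hAA', hA', hcard⟩ := (Finset.mem_filter.1 hQ).2
        exact dataLaw_real_cutWeight_compl_le hθ hT hn hp hA hAA' hA' hcard
    _ ≤ ∑ Q : Finset (Fin n) × Finset (Fin n),
          (n : ℝ)⁻¹ ^ 3 * ((n : ℝ)⁻¹ ^ Q.1.card * (n : ℝ)⁻¹ ^ Q.2.card) :=
        Finset.sum_le_univ_sum_of_nonneg fun _ => by positivity
    _ = (n : ℝ)⁻¹ ^ 3 * ((∑ A : Finset (Fin n), (n : ℝ)⁻¹ ^ A.card) *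
          ∑ A : Finset (Fin n), (n : ℝ)⁻¹ ^ A.card) := by
        rw [← Finset.mul_sum, Fintype.sum_prod_type, Finset.sum_mul_sum]
    _ ≤ (n : ℝ)⁻¹ ^ 3 * (3 * 3) := by gcongr
    _ = 9 / (n : ℝ) ^ 3 := by
        rw [inv_pow]
        ring

lemma dataLaw_real_lt_abs_sum_totalScore_le (hθ : 1 < θ) (hn : 2 ≤ n)
    (hp : Real.log n ≤ n * p) (i : Fin n) :
    (dataLaw θ T p u).real
      {d | (T + 3) * √(n * p * Real.log n) < |∑ j, totalScore θ d u i j|} ≤ 2 * (n : ℝ)⁻¹ ^ 3 := by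
  have := isProbabilityMeasure_dataLaw hθ T p u
  have hL : 0 < Real.log n := Real.log_pos (by exact_mod_cast hn)
  have hX : 0 < n * (p : ℝ) := hL.trans_le hp
  set σ : ℝ := √(Real.log n / (n * p))
  set s : ℝ := (T + 3) * √(n * p * Real.log n)
  have hσ0 : 0 ≤ σ := Real.sqrt_nonneg _
  have hσ1 : σ ≤ 1 := Real.sqrt_le_one.2 ((div_le_one hX).2 hp)
  have hσsq : σ ^ 2 * (n * p) = Real.log n := by
    rw [Real.sq_sqrt (by positivity), div_mul_cancel₀ _ hX.ne']
  have hσs : σ * s = (T + 3) * Real.log n := by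
    rw [mul_left_comm, ← Real.sqrt_mul (by positivity),
      ← mul_assoc, div_mul_cancel₀ _ hX.ne', Real.sqrt_mul_self hL.le]
  have htail (τ : ℝ) (hτ : |τ| = σ) :
      (dataLaw θ T p u).real {d | σ * s ≤ τ * ∑ j, totalScore θ d u i j} ≤ (n : ℝ)⁻¹ ^ 3 := by
    refine (dataLaw_real_le_mul_sum_totalScore hθ (hτ.trans_le hσ1) i _).trans_eq ?_
    rw [← exp_neg_mul_log (by lia), ← sq_abs, hτ, mul_assoc, hσsq, hσs]
    push_cast
    ring_nf
  have hsub : {d : Data n T | s < |∑ j, totalScore θ d u i j|} ⊆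
      {d | σ * s ≤ σ * ∑ j, totalScore θ d u i j} ∪
        {d | σ * s ≤ -σ * ∑ j, totalScore θ d u i j} := by
    intro d hd
    rw [Set.mem_ofPred_eq, lt_abs] at hd
    rcases hd with h | h
    · exact .inl (mul_le_mul_of_nonneg_left h.le hσ0)
    · exact .inr (by simpa using mul_le_mul_of_nonneg_left h.le hσ0)
  calc _ ≤ _ := measureReal_mono hsub (measure_ne_top _ _)
    _ ≤ _ := measureReal_union_le _ _
    _ ≤ (n : ℝ)⁻¹ ^ 3 + (n : ℝ)⁻¹ ^ 3 :=
        add_le_add (htail σ (abs_of_nonneg hσ0)) (htail (-σ) (by rw [abs_neg, abs_of_nonneg hσ0]))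
    _ = 2 * (n : ℝ)⁻¹ ^ 3 := by ring

lemma dataLaw_real_exists_lt_abs_sum_totalScore_le (hθ : 1 < θ) (hn : 2 ≤ n)
    (hp : Real.log n ≤ n * p) :
    (dataLaw θ T p u).real
      {d | ∃ i, (T + 3) * √(n * p * Real.log n) < |∑ j, totalScore θ d u i j|} ≤
        2 / (n : ℝ) ^ 2 := by
  rw [Set.ofPred_exists]
  calc _ ≤ ∑ i : Fin n, (dataLaw θ T p u).real
          {d | (T + 3) * √(n * p * Real.log n) < |∑ j, totalScore θ d u i j|} :=
        measureReal_iUnion_fintype_le _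
    _ ≤ ∑ _i : Fin n, 2 * (n : ℝ)⁻¹ ^ 3 :=
        Finset.sum_le_sum fun i _ => dataLaw_real_lt_abs_sum_totalScore_le hθ hn hp i
    _ = 2 / (n : ℝ) ^ 2 := by
        rw [Finset.sum_const, Finset.card_univ, Fintype.card_fin, nsmul_eq_mul]
        field_simp

end UnionBounds

/-! ### Consistency -/

/-- The event that the maximum likelihood estimate exists, is unique, and is within `ε` of the score
vector `u`. -/
def consistentEvent (θ : ℝ) (T : ℕ) {n : ℕ} (u : Fin n → ℝ) (ε : ℝ) : Set (Data n T) :=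
  {d | ∃ v : Fin n → ℝ, IsMLE θ d v ∧ (∀ w, IsMLE θ d w → w = v) ∧ ‖v - u‖ ≤ ε}

/-- The constant `c` for which the flow sent by a potential drop of `c * e ^ M * √(log n / (n * p))`
through `n * p / 8` comparisons is the bound `(T + 3) * √(n * p * log n)` on the total scores. -/
def rateConst (θ : ℝ) (T : ℕ) : ℝ := 32 * Real.exp 1 * θ * (T + 3)

section Deterministic

variable {θ : ℝ} {n T : ℕ}

lemma existsUnique_isMLE_of_mem_consistentEvent {u : Fin n → ℝ} {ε : ℝ} {d : Data n T}
    (hd : d ∈ consistentEvent θ T u ε) : ∃! v : Fin n → ℝ, IsMLE θ d v :=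
  let ⟨v, hv, huniq, _⟩ := hd
  ⟨v, hv, huniq⟩

lemma IsMLE.norm_sub_le_of_mem_consistentEvent {u v : Fin n → ℝ} {ε : ℝ} {d : Data n T}
    (hv : IsMLE θ d v) (hd : d ∈ consistentEvent θ T u ε) : ‖v - u‖ ≤ ε := by
  obtain ⟨v', -, huniq, hle⟩ := hd
  rwa [huniq v hv]

lemma dynamicRange_nonneg (u : Fin n → ℝ) : 0 ≤ dynamicRange u :=
  Real.iSup_nonneg fun _ => abs_nonneg _

lemma slope_mul_rateConst (hθ : 0 < θ) (T : ℕ) (M : ℝ) {L X : ℝ} (hL : 0 ≤ L) (hX : 0 < X) :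
    slope θ M * (rateConst θ T * (Real.exp M * √(L / X))) * (X / 8) = (T + 3) * √(X * L) := by
  have hexp : Real.exp (-(M + 1)) * (Real.exp 1 * Real.exp M) = 1 := by
    rw [← Real.exp_add, ← Real.exp_add, neg_add_eq_zero.2 (add_comm M 1), Real.exp_zero]
  have hsqrt : √(L / X) * X = √(X * L) := by
    rw [Real.sqrt_div hL, mul_comm X, Real.sqrt_mul hL, div_mul_eq_mul_div, mul_div_assoc,
      Real.div_sqrt]
  rw [slope, rateConst, ← hsqrt]
  field_simp
  linear_combination 32 * √(L / X) * hexp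

lemma exists_exp_le_pow {L x r : ℝ} (hx : 0 < x) (hr : 0 < r) (hxr : x / 4 ≤ Real.log r)
    (hxL : x ≤ L) : ∃ K : ℕ, Real.exp L ≤ r ^ K ∧ (K : ℝ) ≤ 5 * (L / x) := by
  have hLx : 1 ≤ L / x := (one_le_div hx).2 hxL
  refine ⟨⌈4 * (L / x)⌉₊, ?_, ?_⟩
  · have hL : L ≤ ⌈4 * (L / x)⌉₊ * Real.log r := by
      calc L = 4 * (L / x) * (x / 4) := by field_simp
        _ ≤ ⌈4 * (L / x)⌉₊ * Real.log r := by
            gcongr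
            exact Nat.le_ceil _
    rwa [← Real.le_log_iff_exp_le (by positivity), Real.log_pow]
  · linarith [Nat.ceil_lt_add_one (a := 4 * (L / x)) (by positivity)]

lemma log_div_four_le_log_div {L X : ℝ} (hL : 4096 ≤ L) (hX : L ^ 2 ≤ X) :
    Real.log X / 4 ≤ Real.log (X / (64 * L)) := by
  have hL0 : 0 < L := by linarith
  have hX0 : 0 < X := (by positivity : 0 < L ^ 2).trans_le hX
  have hlogX : 2 * Real.log L ≤ Real.log X := by
    simpa [Real.log_pow] using Real.log_le_log (by positivity) hX
  have hlogL : 2 * Real.log 64 ≤ Real.log L := by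
    have hlog := Real.log_le_log (by norm_num) (show (64 : ℝ) ^ 2 ≤ L by linarith)
    simpa [Real.log_pow] using hlog
  rw [Real.log_div hX0.ne' (by positivity), Real.log_mul (by norm_num) hL0.ne']
  linarith

lemma mem_consistentEvent_of_expands (hθ : 1 < θ) {p : unitInterval} {u : Fin n → ℝ}
    (hu : u ∈ normalized n) (hn : 0 < n) (hL : 4096 ≤ Real.log n)
    (hX : Real.log n ^ 2 ≤ n * p) (hrate : rateConst θ T * rate p u ≤ 1) {d : Data n T}
    (hexp : Expands (comparisonCount d) (n * p / (64 * Real.log n)) (n * p / 8))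
    (hscore : ∀ i, |∑ j, totalScore θ d u i j| ≤ (T + 3) * √(n * p * Real.log n)) :
    d ∈ consistentEvent θ T u (10 * rateConst θ T * rate p u) := by
  have hn0 : (0 : ℝ) < n := by exact_mod_cast hn
  set L := Real.log n
  set X : ℝ := n * p
  set M := dynamicRange u
  have hX1 : 1 < X := by nlinarith
  have hlogX : 0 < Real.log X := Real.log_pos hX1
  have hXL : Real.log X ≤ L :=
    Real.log_le_log (by linarith) (mul_le_of_le_one_right hn0.le p.2.2)
  have hr := log_div_four_le_log_div hL hX
  have hr0 : 0 < X / (64 * L) := by positivity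
  have hr1 : 1 ≤ X / (64 * L) := ((Real.log_pos_iff hr0.le).1 (by linarith)).le
  obtain ⟨K, hexpK, hK⟩ := exists_exp_le_pow hlogX hr0 hr hXL
  rw [Real.exp_log hn0] at hexpK
  have hconst : 0 < rateConst θ T := by
    unfold rateConst
    positivity
  set h := rateConst θ T * (Real.exp M * √(L / X)) with hh
  have hh0 : 0 < h := by positivity
  have hhrate : h * (L / Real.log X) ≤ rateConst θ T * rate p u := by
    have hM : Real.exp M ≤ Real.exp (2 * M) := by
      gcongr
      linarith [dynamicRange_nonneg u]
    rw [rate, hh, mul_assoc (rateConst θ T)]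
    gcongr
  have hh1 : h ≤ 1 :=
    (le_mul_of_one_le_right hh0.le ((one_le_div hlogX).2 hXL)).trans (hhrate.trans hrate)
  obtain ⟨v, hv, huniq, hle⟩ := exists_unique_isMLE_of_expands hθ hn hu hh0 hh1 hr1
    (by positivity) (slope_mul_rateConst (by linarith) T M (by linarith) (by linarith)).ge
    hexpK hexp hscore
  refine ⟨v, hv, huniq, hle.trans ?_⟩
  calc 2 * K * h ≤ 2 * (5 * (L / Real.log X)) * h := by gcongr
    _ = 10 * (h * (L / Real.log X)) := by ring
    _ ≤ 10 * rateConst θ T * rate p u := by linarith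

lemma sq_le_of_pow_three_le_mul_log_sq {L X : ℝ} (hL : 0 < L) (hlogL : 4 * Real.log L ^ 2 ≤ L)
    (hX : 1 < X) (h : L ^ 3 ≤ X * Real.log X ^ 2) : L ^ 2 ≤ X := by
  by_contra! hlt
  have hlogX : 0 < Real.log X := Real.log_pos hX
  have hlog : Real.log X ≤ 2 * Real.log L := by
    simpa [Real.log_pow] using Real.log_le_log (by linarith) hlt.le
  have : X * Real.log X ^ 2 < L ^ 3 := by
    calc X * Real.log X ^ 2 < L ^ 2 * Real.log X ^ 2 := by gcongr
      _ ≤ L ^ 2 * (2 * Real.log L) ^ 2 := by gcongr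
      _ = L ^ 2 * (4 * Real.log L ^ 2) := by ring
      _ ≤ L ^ 2 * L := by gcongr
      _ = L ^ 3 := by ring
  linarith

lemma log_pow_three_le_of_rate_le_one {p : unitInterval} {u : Fin n → ℝ} (hX : 1 < n * (p : ℝ))
    (hrate : rate p u ≤ 1) :
    Real.log n ^ 3 ≤ n * p * Real.log (n * p) ^ 2 := by
  have hlogX := Real.log_pos hX
  have hsqrt : √(Real.log n / (n * p)) * (Real.log n / Real.log (n * p)) ≤ 1 := by
    refine le_trans ?_ hrate
    rw [rate, mul_assoc]
    exact le_mul_of_one_le_left (by positivity)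
      (Real.one_le_exp (mul_nonneg zero_le_two (dynamicRange_nonneg u)))
  have hsq := pow_le_one₀ (n := 2) (by positivity) hsqrt
  rw [mul_pow, Real.sq_sqrt (by positivity), div_pow, div_mul_div_comm,
    div_le_one (by positivity)] at hsq
  linarith [pow_succ' (Real.log n) 2]

end Deterministic

section Asymptotics

variable {θ : ℝ} {T : ℕ} {p : ℕ → unitInterval} {u : (n : ℕ) → Fin n → ℝ}

lemma dataLaw_real_compl_consistentEvent_le (hθ : 1 < θ) (hT : 1 ≤ T) {n : ℕ} {p : unitInterval}
    {u : Fin n → ℝ} (hu : u ∈ normalized n) (hn : 2 ≤ n) (hL : 4096 ≤ Real.log n)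
    (hX : Real.log n ^ 2 ≤ n * p) (hrate : rateConst θ T * rate p u ≤ 1) :
    (dataLaw θ T p u).real (consistentEvent θ T u (10 * rateConst θ T * rate p u))ᶜ ≤
      11 / (n : ℝ) ^ 2 := by
  have := isProbabilityMeasure_dataLaw hθ T p u
  have hn1 : (1 : ℝ) ≤ n := by exact_mod_cast (by lia : 1 ≤ n)
  have hsub : (consistentEvent θ T u (10 * rateConst θ T * rate p u))ᶜ ⊆
      {d | ¬ Expands (comparisonCount d) (n * p / (64 * Real.log n)) (n * p / 8)} ∪
      {d | ∃ i, (T + 3) * √(n * p * Real.log n) < |∑ j, totalScore θ d u i j|} := by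
    refine fun d hd => or_iff_not_imp_left.2 fun hexp => ?_
    by_contra hscore
    simp only [Set.mem_ofPred_eq, not_not, not_exists, not_lt] at hexp hscore
    exact hd (mem_consistentEvent_of_expands hθ hu (by lia) hL hX hrate hexp hscore)
  calc _ ≤ _ := measureReal_mono hsub (measure_ne_top _ _)
    _ ≤ _ := measureReal_union_le _ _
    _ ≤ 9 / (n : ℝ) ^ 3 + 2 / (n : ℝ) ^ 2 :=
        add_le_add (dataLaw_real_not_expands_le hθ hT hn (by nlinarith))
          (dataLaw_real_exists_lt_abs_sum_totalScore_le hθ hn (by nlinarith))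
    _ ≤ 9 / (n : ℝ) ^ 2 + 2 / (n : ℝ) ^ 2 := by
        gcongr
        norm_num
    _ = 11 / (n : ℝ) ^ 2 := by ring

lemma tendsto_log_natCast_atTop : Tendsto (fun n : ℕ => Real.log n) atTop atTop :=
  Real.tendsto_log_atTop.comp tendsto_natCast_atTop_atTop

lemma eventually_one_lt_natCast_mul
    (hp : ∃ c : ℝ, 1 < c ∧ ∀ᶠ n : ℕ in atTop, c * (Real.log n / n) ≤ (p n : ℝ)) :
    ∀ᶠ n : ℕ in atTop, 1 < n * (p n : ℝ) := by
  obtain ⟨c, hc, hp⟩ := hp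
  filter_upwards [hp, tendsto_log_natCast_atTop.eventually_ge_atTop 1, eventually_gt_atTop 0]
    with n hpn hlog hn
  calc 1 < c * Real.log n := by nlinarith
    _ = n * (c * (Real.log n / n)) := by field_simp
    _ ≤ n * p n := by gcongr

lemma eventually_four_mul_log_sq_le : ∀ᶠ x : ℝ in atTop, 4 * Real.log x ^ 2 ≤ x := by
  have hlog := (Real.isLittleO_pow_log_id_atTop (n := 2)).bound (by norm_num : (0 : ℝ) < 1 / 4)
  filter_upwards [hlog, eventually_ge_atTop 0] with x hx hx0
  rw [Real.norm_of_nonneg (sq_nonneg _), id, Real.norm_of_nonneg hx0] at hx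
  linarith

lemma eventually_sq_log_le (hX : ∀ᶠ n : ℕ in atTop, 1 < n * (p n : ℝ))
    (hΔ : Tendsto (fun n => rate (p n) (u n)) atTop (𝓝 0)) :
    ∀ᶠ n : ℕ in atTop, Real.log n ^ 2 ≤ n * (p n : ℝ) := by
  filter_upwards [hX, tendsto_log_natCast_atTop.eventually eventually_four_mul_log_sq_le,
    tendsto_log_natCast_atTop.eventually_gt_atTop 0, hΔ.eventually_le_const one_pos]
    with n hXn hlog hL hrate
  exact sq_le_of_pow_three_le_mul_log_sq hL hlog hXn (log_pow_three_le_of_rate_le_one hXn hrate)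

lemma tendsto_const_mul_rate (c : ℝ) (hΔ : Tendsto (fun n => rate (p n) (u n)) atTop (𝓝 0)) :
    Tendsto (fun n => c * rate (p n) (u n)) atTop (𝓝 0) := by
  simpa using hΔ.const_mul c

lemma eventually_dataLaw_real_compl_consistentEvent_le (hθ : 1 < θ) (hT : 1 ≤ T)
    (hu : ∀ n, u n ∈ normalized n) (hX : ∀ᶠ n : ℕ in atTop, 1 < n * (p n : ℝ))
    (hΔ : Tendsto (fun n => rate (p n) (u n)) atTop (𝓝 0)) :
    ∀ᶠ n : ℕ in atTop, (dataLaw θ T (p n) (u n)).real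
      (consistentEvent θ T (u n) (10 * rateConst θ T * rate (p n) (u n)))ᶜ ≤ 11 / (n : ℝ) ^ 2 := by
  filter_upwards [eventually_sq_log_le hX hΔ, tendsto_log_natCast_atTop.eventually_ge_atTop 4096,
    (tendsto_const_mul_rate (rateConst θ T) hΔ).eventually_le_const one_pos,
    eventually_ge_atTop 2] with n hsq hL hrate hn
  exact dataLaw_real_compl_consistentEvent_le hθ hT (hu n) hn hL hsq hrate

lemma one_sub_measureReal_compl_le {E : Type*} [MeasurableSpace E] (ν : Measure E)
    [IsProbabilityMeasure ν] (A : Set E) : 1 - ν.real Aᶜ ≤ ν.real A := by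
  rw [sub_le_iff_le_add, ← probReal_univ (μ := ν), ← Set.union_compl_self A]
  exact measureReal_union_le A Aᶜ

lemma ae_eventually_notMem_of_hasLaw {E : ℕ → Type*} [∀ n, MeasurableSpace (E n)]
    {ν : ∀ n, Measure (E n)} [∀ n, IsFiniteMeasure (ν n)] {B : ∀ n, Set (E n)}
    (hB : Summable fun n => (ν n).real (B n)) {Ω : Type*} [MeasurableSpace Ω] {μ : Measure Ω}
    {D : ∀ n, Ω → E n} (hD : ∀ n, HasLaw (D n) (ν n) μ) :
    ∀ᵐ ω ∂μ, ∀ᶠ n in atTop, D n ω ∉ B n := by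
  have hle (n : ℕ) : μ (D n ⁻¹' B n) ≤ ENNReal.ofReal ((ν n).real (B n)) := by
    rw [ofReal_measureReal, ← (hD n).map_eq]
    exact Measure.le_map_apply (hD n).aemeasurable _
  exact ae_eventually_notMem
    (ne_top_of_le_ne_top hB.tsum_ofReal_ne_top (ENNReal.tsum_le_tsum hle))

lemma ae_eventually_mem_consistentEvent (hθ : 1 < θ) {ε : ℕ → ℝ}
    (hε : ∀ᶠ n : ℕ in atTop, (dataLaw θ T (p n) (u n)).real
      (consistentEvent θ T (u n) (ε n))ᶜ ≤ 11 / (n : ℝ) ^ 2)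
    {Ω : Type*} [MeasurableSpace Ω] {μ : Measure Ω} {D : (n : ℕ) → Ω → Data n T}
    (hD : ∀ n, HasLaw (D n) (dataLaw θ T (p n) (u n)) μ) :
    ∀ᵐ ω ∂μ, ∀ᶠ n in atTop, D n ω ∈ consistentEvent θ T (u n) (ε n) := by
  have (n : ℕ) := isProbabilityMeasure_dataLaw hθ T (p n) (u n)
  have hinv : Summable fun n : ℕ => 11 / (n : ℝ) ^ 2 := by
    simpa only [div_eq_mul_inv] using
      ((Real.summable_nat_pow_inv (p := 2)).2 one_lt_two).mul_left 11
  have hsum : Summable fun n =>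
      (dataLaw θ T (p n) (u n)).real (consistentEvent θ T (u n) (ε n))ᶜ :=
    hinv.of_norm_bounded_eventually_nat <| hε.mono fun n hn => by
      rwa [Real.norm_of_nonneg measureReal_nonneg]
  simpa only [Set.mem_compl_iff, not_not] using ae_eventually_notMem_of_hasLaw hsum hD

end Asymptotics

end

end RaoKupper

theorem mainTheorem8 (θ : ℝ) (hθ : 1 < θ) (T : ℕ) (hT : 1 ≤ T)
    (p : ℕ → unitInterval) (u : (n : ℕ) → Fin n → ℝ)
    (hu : ∀ n, u n ∈ RaoKupper.normalized n)
    (hp : ∃ c : ℝ, 1 < c ∧ ∀ᶠ n : ℕ in atTop, c * (Real.log n / n) ≤ (p n : ℝ))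
    (hΔ : Tendsto (fun n : ℕ => RaoKupper.rate (p n) (u n)) atTop (𝓝 0)) :
    -- with probability at least `1 - 14 / n ^ 2` the MLE uniquely exists and has error `O(Δ_n)`
    (∃ C : ℝ, ∀ᶠ n : ℕ in atTop,
      1 - 14 / (n : ℝ) ^ 2 ≤ (RaoKupper.dataLaw θ T (p n) (u n)).real
        {d | ∃ v : Fin n → ℝ, RaoKupper.IsMLE θ d v ∧ (∀ w, RaoKupper.IsMLE θ d w → w = v) ∧
          ‖v - u n‖ ≤ C * RaoKupper.rate (p n) (u n)}) ∧
    -- however the data for different `n` are coupled, almost surely the MLE uniquely exists for all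
    -- but finitely many `n` and converges uniformly to the true scores
    (∀ {Ω : Type*} [MeasurableSpace Ω] (μ : Measure Ω) [IsProbabilityMeasure μ]
      (D : (n : ℕ) → Ω → RaoKupper.Data n T),
      (∀ n, HasLaw (D n) (RaoKupper.dataLaw θ T (p n) (u n)) μ) →
      ∀ᵐ ω ∂μ,
        (∀ᶠ n : ℕ in atTop, ∃! v : Fin n → ℝ, RaoKupper.IsMLE θ (D n ω) v) ∧
        ∀ uhat : (n : ℕ) → Fin n → ℝ,
          (∀ᶠ n : ℕ in atTop, RaoKupper.IsMLE θ (D n ω) (uhat n)) →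
          Tendsto (fun n : ℕ => ‖uhat n - u n‖) atTop (𝓝 0)) := by
  have hbad := RaoKupper.eventually_dataLaw_real_compl_consistentEvent_le hθ hT hu
    (RaoKupper.eventually_one_lt_natCast_mul hp) hΔ
  refine ⟨⟨10 * RaoKupper.rateConst θ T, ?_⟩, fun μ _ D hD => ?_⟩
  · filter_upwards [hbad] with n hn
    have := RaoKupper.isProbabilityMeasure_dataLaw hθ T (p n) (u n)
    refine le_trans ?_ (RaoKupper.one_sub_measureReal_compl_le _ _)
    gcongr
    exact hn.trans (by gcongr; norm_num)
  · filter_upwards [RaoKupper.ae_eventually_mem_consistentEvent hθ hbad hD] with ω hω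
    refine ⟨hω.mono fun n hn => RaoKupper.existsUnique_isMLE_of_mem_consistentEvent hn,
      fun uhat huhat => ?_⟩
    refine squeeze_zero' (.of_forall fun n => norm_nonneg _) ?_
      (RaoKupper.tendsto_const_mul_rate (10 * RaoKupper.rateConst θ T) hΔ)
    filter_upwards [hω, huhat] with n hn hmle
    exact hmle.norm_sub_le_of_mem_consistentEvent hn
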